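/- Let $F$ be a field with $\operatorname{char} F\neq 2$ and let $K=F(\sqrt{a_1},\sqrt{a_2})$ ($a_1,a_2\in F$) be a Galois extension with $G=\operatorname{Gal}(K/F)\simeq \mathbb Z/2\oplus\mathbb Z/2$, generated by $\sigma_1,\sigma_2$ with $\sigma_i(\sqrt{a_j})=(-1)^{\delta_{ij}}\sqrt{a_j}$. Put $K_1=F(\sqrt{a_1})$, $K_2=F(\sqrt{a_2})$, $K_3=F(\sqrt{a_1}\sqrt{a_2})$. Let $J(K)=K^\times/K^{\times 2}$, an $\mathbb F_2[G]$-module written multiplicatively with exponential action, let $[\gamma]\in J(K)$ be the class of $\gamma\in K^\times$, and let $[F^\times]$, $[N_{K/K_i}(K^\times)]$ be the sets of classes of elements of $F^\times$, resp. of norms from $K$ to $K_i$. For submodules $U,V$ of $J(K)$ write $U+V=\{uv:u\in U,v\in V\}$, and write $M^G$ for the fixed part of a module $M$. Let $\mathfrak B$, $\mathfrak C$, $\mathfrak D$ be the subspaces of those $[f]\in[F^\times]$ for which there is $[\gamma]\in J(K)$ with, respectively, $[\gamma]^{1+\sigma_1}=[f]$ and $[\gamma]^{1+\sigma_2}=[1]$;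 $[\gamma]^{1+\sigma_2}=[f]$ and $[\gamma]^{1+\sigma_1}=[1]$; $[\gamma]^{1+\sigma_1}=[\gamma]^{1+\sigma_2}=[f]$. For $n\ge 1$ let $\Omega^{-n}$ be the $\mathbb F_2[G]$-module of dimension $2n+1$ with basis $\alpha_1,\dots,\alpha_n,\beta_1,\dots,\beta_{n+1}$, in which the $\beta_j$ are fixed by $G$ and $\alpha_i^{1+\sigma_2}=\beta_i$, $\alpha_i^{1+\sigma_1}=\beta_{i+1}$. For $i=1,2,3$ the group $(K_i^\times\cap K^{\times2})/K_i^{\times2}$ has order $2$. Let $$T:J(K)^G\to\bigoplus_{i=1}^3 (K_i^\times\cap K^{\times2})/K_i^{\times2}$$ be the $\mathbb F_2$-linear map sending $[\gamma]$ to the triple of the classes of $N_{K/K_1}(\gamma)$, $N_{K/K_2}(\gamma)$, $N_{K/K_3}(\gamma)$. Then $\ker T=[F^\times]$. A coordinate plane is one of the three subspaces of the target of $T$ consisting of all triples whose $i$-th coordinate is trivial, for a fixed $i$. Let $S=[N_{K/K_1}(K^\times)]\cap[N_{K/K_2}(K^\times)]$, which is contained in $J(K)^G$. There is a submodule $X\subseteq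 J(K)$ with $T(X^G)=\operatorname{im}T$ such that $$X\simeq\begin{cases}\{[1]\} & \text{if }\dim\operatorname{im}T=0,\\ \mathbb F_2 & \text{if }\dim\operatorname{im}T=1,\\ \Omega^{-1} & \text{if }\dim\operatorname{im}T=2\text{ and }\operatorname{im}T\text{ is a coordinate plane},\\ \mathbb F_2\oplus\mathbb F_2 & \text{if }\dim\operatorname{im}T=2\text{ and }\operatorname{im}T\text{ is not a coordinate plane},\\ \Omega^{-2} & \text{if }\dim\operatorname{im}T=3\text{ and }T(S)\text{ is nontrivial},\\ \Omega^{-1}\oplus\Omega^{-1} & \text{if }\dim\operatorname{im}T=3\text{ and }T(S)\text{ is trivial}.\end{cases}$$ In all cases except the last, $[F^\times]\cap X^G=\{[1]\}$; in the last case $\dim(X^G\cap[F^\times])=1$ and $X^G\cap(\mathfrak B+\mathfrak C+\mathfrak D)=\{[1]\}$. -/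

import Mathlib

open scoped IntermediateField

noncomputable section

namespace Biquadratic

/-- The group `J(L) = Lˣ / Lˣ²` of square classes of a field, written additively:
the class `[1]` is `0` and the product `[x][y]` is `[x] + [y]`. -/
def J (L : Type*) [Field L] : Type _ :=
  Additive (Lˣ ⧸ (powMonoidHom 2 : Lˣ →* Lˣ).range)

instance (L : Type*) [Field L] : AddCommGroup (J L) :=
  inferInstanceAs (AddCommGroup (Additive (Lˣ ⧸ (powMonoidHom 2 : Lˣ →* Lˣ).range)))

/-- The class `[x]` of a unit `x`. -/
def cls {L : Type*} [Field L] (x : Lˣ) : J L :=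
  Additive.ofMul (QuotientGroup.mk' (powMonoidHom 2 : Lˣ →* Lˣ).range x)

theorem cls_surjective {L : Type*} [Field L] : Function.Surjective (cls (L := L)) :=
  QuotientGroup.mk'_surjective (powMonoidHom 2 : Lˣ →* Lˣ).range

theorem cls_mul {L : Type*} [Field L] (x y : Lˣ) : cls (x * y) = cls x + cls y := rfl

theorem cls_eq_zero_iff {L : Type*} [Field L] (x : Lˣ) : cls x = 0 ↔ ∃ y : Lˣ, y ^ 2 = x :=
  QuotientGroup.eq_one_iff x

theorem two_nsmul_eq_zero {L : Type*} [Field L] (x : J L) : 2 • x = 0 := by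
  obtain ⟨u, rfl⟩ := cls_surjective x
  rw [two_nsmul, ← cls_mul, cls_eq_zero_iff]
  exact ⟨u, sq u⟩

/-- `J(L)` is a vector space over the field with two elements. -/
instance (L : Type*) [Field L] : Module (ZMod 2) (J L) :=
  AddCommGroup.zmodModule two_nsmul_eq_zero

/-- The linear map on square classes that is induced by a homomorphism of unit groups. -/
def mapJ {L M : Type*} [Field L] [Field M] (f : Lˣ →* Mˣ) : J L →ₗ[ZMod 2] J M :=
  AddMonoidHom.toZModLinearMap 2 (M := J L) (M₁ := J M) <|
    MonoidHom.toAdditive <|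
      QuotientGroup.map (powMonoidHom 2 : Lˣ →* Lˣ).range (powMonoidHom 2 : Mˣ →* Mˣ).range f
        (by
          rintro _ ⟨y, rfl⟩
          exact ⟨f y, by simp⟩)

theorem mapJ_cls {L M : Type*} [Field L] [Field M] (f : Lˣ →* Mˣ) (x : Lˣ) :
    mapJ f (cls x) = cls (f x) := rfl

/-- The map `J(L) → J(M)` induced by the inclusion of `L` in an extension field `M`. -/
def incl (L M : Type*) [Field L] [Field M] [Algebra L M] : J L →ₗ[ZMod 2] J M :=
  mapJ (Units.map (algebraMap L M : L →* M))

/-- The map `J(M) → J(L)` induced by the norm of an extension `M / L`. -/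
def normJ (L M : Type*) [Field L] [Field M] [Algebra L M] : J M →ₗ[ZMod 2] J L :=
  mapJ (Units.map (Algebra.norm L : M →* L))

/-- The kernel `(Lˣ ∩ Mˣ²) / Lˣ²` of `J(L) → J(M)`. -/
abbrev relSq (L M : Type*) [Field L] [Field M] [Algebra L M] : Submodule (ZMod 2) (J L) :=
  LinearMap.ker (incl L M)

variable (F K : Type*) [Field F] [Field K] [Algebra F K]

/-- The `𝔽₂[Gal(K/F)]`-module `J(K)`, as a representation of `Gal(K/F)` over `𝔽₂`. -/
def galJ : Representation (ZMod 2) Gal(K/F) (J K) where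
  toFun g := mapJ (Units.map (g : K →* K))
  map_one' := by
    ext x
    obtain ⟨u, rfl⟩ := cls_surjective x
    rfl
  map_mul' g h := by
    ext x
    obtain ⟨u, rfl⟩ := cls_surjective x
    rfl

/-- The fixed part `J(K)^G`. -/
abbrev fixedJ : Submodule (ZMod 2) (J K) := (galJ F K).invariants

/-- The subspace `[Fˣ]` of `J(K)`. -/
abbrev baseClasses : Submodule (ZMod 2) (J K) := LinearMap.range (incl F K)

/-- The subspace `[N_{K/E}(Kˣ)]` of `J(K)`, for an intermediate field `E`. -/
def normClasses {F K : Type*} [Field F] [Field K] [Algebra F K] (E : IntermediateField F K) :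
    Submodule (ZMod 2) (J K) :=
  LinearMap.range (incl E K ∘ₗ normJ E K)

/-- The Klein four-group `ℤ/2 ⊕ ℤ/2`, written multiplicatively. -/
abbrev Klein : Type := Multiplicative (ZMod 2 × ZMod 2)

/-- The set-up: an isomorphism of `Gal(K/F)` with the Klein four-group, elements `a₁, a₂` of `F`
with chosen square roots `r₁, r₂` in `K` such that `K = F(r₁, r₂)`, and such that the two standard
generators `σ₁, σ₂` of the Galois group are dual to `r₁, r₂`. -/
structure Presentation where
  φ : Gal(K/F) ≃* Klein
  a₁ : F
  a₂ : F
  r₁ : K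
  r₂ : K
  sq_r₁ : r₁ ^ 2 = algebraMap F K a₁
  sq_r₂ : r₂ ^ 2 = algebraMap F K a₂
  adjoin_eq_top : IntermediateField.adjoin F {r₁, r₂} = ⊤
  σ₁_r₁ : φ.symm (Multiplicative.ofAdd (1, 0)) r₁ = -r₁
  σ₁_r₂ : φ.symm (Multiplicative.ofAdd (1, 0)) r₂ = r₂
  σ₂_r₁ : φ.symm (Multiplicative.ofAdd (0, 1)) r₁ = r₁
  σ₂_r₂ : φ.symm (Multiplicative.ofAdd (0, 1)) r₂ = -r₂

variable {F K}

/-- If a nontrivial involution `σ` of `K / F` fixes the generator of `E = F(r)`, then the norm to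
`E` of a class in `J(K)^G` lies in `(Eˣ ∩ Kˣ²) / Eˣ²`. -/
theorem normJ_mem_relSq [IsGalois F K] (r : K) (σ : Gal(K/F)) (hσ : σ ≠ 1) (hσ2 : σ ^ 2 = 1)
    (hr : σ r = r) {x : J K} (hx : x ∈ fixedJ F K) :
    normJ F⟮r⟯ K x ∈ relSq F⟮r⟯ K := by
  obtain ⟨u, rfl⟩ := cls_surjective x
  rw [LinearMap.mem_ker]
  by_cases hfin : FiniteDimensional F⟮r⟯ K
  · have hfix : ∀ y : F⟮r⟯, σ (y : K) = y := by
      intro y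
      have hle : F⟮r⟯ ≤ IntermediateField.fixedField (Subgroup.zpowers σ) := by
        rw [IntermediateField.adjoin_simple_le_iff, IntermediateField.mem_fixedField_iff]
        intro f hf
        obtain ⟨n, rfl⟩ := Subgroup.mem_zpowers_iff.1 hf
        have : Subgroup.zpowers σ ≤ MulAction.stabilizer Gal(K/F) r := by
          rw [Subgroup.zpowers_le]
          exact hr
        exact this (Subgroup.zpow_mem_zpowers σ n)
      exact (IntermediateField.mem_fixedField_iff _ _).1 (hle y.2) σ
        (Subgroup.mem_zpowers σ)
    let τ : Gal(K/F⟮r⟯) := { σ with commutes' := hfix }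
    have hτ : τ ≠ 1 := by
      intro h
      apply hσ
      ext z
      exact DFunLike.congr_fun h z
    have hτ2 : τ ^ 2 = 1 := by
      ext z
      exact DFunLike.congr_fun hσ2 z
    have hcard : 2 ∣ Fintype.card Gal(K/F⟮r⟯) := by
      rw [← orderOf_eq_prime hτ2 hτ]
      exact orderOf_dvd_card
    have hg : ∀ g : Gal(K/F⟮r⟯), cls (Units.map (g : K →* K) u) = cls u := fun g =>
      hx (g.restrictScalars F)
    have hprod : ∀ s : Finset Gal(K/F⟮r⟯),
        cls (∏ g ∈ s, Units.map (g : K →* K) u) = s.card • cls u := by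
      classical
      intro s
      induction s using Finset.induction_on with
      | empty => rw [Finset.prod_empty, Finset.card_empty, zero_smul]; rfl
      | insert a s ha ih =>
        rw [Finset.prod_insert ha, cls_mul, ih, hg, Finset.card_insert_of_notMem ha, add_smul,
          one_smul, add_comm]
    have heq : Units.map (algebraMap F⟮r⟯ K : F⟮r⟯ →* K) (Units.map (Algebra.norm F⟮r⟯) u) =
        ∏ g : Gal(K/F⟮r⟯), Units.map (g : K →* K) u := by
      ext
      have := Algebra.norm_eq_prod_automorphisms F⟮r⟯ (u : K)
      simpa [Units.coe_prod] using this
    obtain ⟨m, hm⟩ := hcard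
    change cls (Units.map (algebraMap F⟮r⟯ K : F⟮r⟯ →* K) (Units.map (Algebra.norm F⟮r⟯) u)) = 0
    rw [heq, hprod, Finset.card_univ, hm, mul_comm, mul_smul, two_nsmul_eq_zero, smul_zero]
  · have h1 : Units.map (Algebra.norm F⟮r⟯ : K →* F⟮r⟯) u = 1 := by
      ext1
      exact Algebra.norm_eq_one_of_not_module_finite hfin _
    change cls (Units.map (algebraMap F⟮r⟯ K : F⟮r⟯ →* K) (Units.map (Algebra.norm F⟮r⟯) u)) = 0
    rw [h1, map_one]
    rfl

namespace Presentation

variable (B : Presentation F K)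

/-- The generator `σ₁`: it negates `r₁` and fixes `r₂`. -/
abbrev σ₁ : Gal(K/F) := B.φ.symm (Multiplicative.ofAdd (1, 0))

/-- The generator `σ₂`: it fixes `r₁` and negates `r₂`. -/
abbrev σ₂ : Gal(K/F) := B.φ.symm (Multiplicative.ofAdd (0, 1))

/-- `K₁ = F(√a₁)`. -/
abbrev K₁ : IntermediateField F K := F⟮B.r₁⟯

/-- `K₂ = F(√a₂)`. -/
abbrev K₂ : IntermediateField F K := F⟮B.r₂⟯

/-- `K₃ = F(√(a₁a₂))`. -/
abbrev K₃ : IntermediateField F K := F⟮B.r₁ * B.r₂⟯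

theorem symm_ne_one {g : Klein} (hg : g ≠ 1) : B.φ.symm g ≠ 1 := by
  simpa using hg

theorem symm_sq (g : Klein) : B.φ.symm g ^ 2 = 1 := by
  rw [← map_pow, MulEquiv.map_eq_one_iff]
  revert g
  decide

/-- The map `T : J(K)^G → ⨁ᵢ (Kᵢˣ ∩ Kˣ²) / Kᵢˣ²`, sending `[γ]` to the classes of its norms to
`K₁`, `K₂` and `K₃`. -/
def T [IsGalois F K] :
    fixedJ F K →ₗ[ZMod 2] relSq B.K₁ K × relSq B.K₂ K × relSq B.K₃ K :=
  LinearMap.prod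
    (LinearMap.codRestrict (relSq B.K₁ K) (normJ B.K₁ K ∘ₗ (fixedJ F K).subtype) fun x =>
      normJ_mem_relSq B.r₁ B.σ₂ (B.symm_ne_one (by decide)) (B.symm_sq _) B.σ₂_r₁ x.2)
    (LinearMap.prod
      (LinearMap.codRestrict (relSq B.K₂ K) (normJ B.K₂ K ∘ₗ (fixedJ F K).subtype) fun x =>
        normJ_mem_relSq B.r₂ B.σ₁ (B.symm_ne_one (by decide)) (B.symm_sq _) B.σ₁_r₂ x.2)
      (LinearMap.codRestrict (relSq B.K₃ K) (normJ B.K₃ K ∘ₗ (fixedJ F K).subtype) fun x =>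
        normJ_mem_relSq (B.r₁ * B.r₂) (B.φ.symm (Multiplicative.ofAdd (1, 1)))
          (B.symm_ne_one (by decide)) (B.symm_sq _)
          (by
            have h : (Multiplicative.ofAdd (1, 1) : Klein) =
              Multiplicative.ofAdd (1, 0) * Multiplicative.ofAdd (0, 1) := by decide
            rw [h, map_mul B.φ.symm, AlgEquiv.mul_apply, map_mul, B.σ₂_r₁, B.σ₂_r₂, map_mul, map_neg,
              B.σ₁_r₁, B.σ₁_r₂, neg_mul_neg]) x.2))

/-- The image under `T` of the elements of a subspace `S` of `J(K)` that are fixed by `G`. -/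
def imT [IsGalois F K] (S : Submodule (ZMod 2) (J K)) :
    Submodule (ZMod 2) (relSq B.K₁ K × relSq B.K₂ K × relSq B.K₃ K) :=
  (S.comap (fixedJ F K).subtype).map B.T

/-- `P` is one of the three coordinate planes of the target of `T`, in which one of the three
coordinates is trivial. -/
def IsCoordinatePlane
    (P : Submodule (ZMod 2) (relSq B.K₁ K × relSq B.K₂ K × relSq B.K₃ K)) : Prop :=
  (∀ p, p ∈ P ↔ p.1 = 0) ∨ (∀ p, p ∈ P ↔ p.2.1 = 0) ∨ (∀ p, p ∈ P ↔ p.2.2 = 0)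

/-- The operator `1 + σ₁` on `J(K)`. -/
abbrev D₁ : J K →ₗ[ZMod 2] J K := LinearMap.id + galJ F K B.σ₁

/-- The operator `1 + σ₂` on `J(K)`. -/
abbrev D₂ : J K →ₗ[ZMod 2] J K := LinearMap.id + galJ F K B.σ₂

/-- `𝔅`: the classes `[f] ∈ [Fˣ]` such that some `[γ] ∈ J(K)` has
`[γ]^(1+σ₁) = [f]` and `[γ]^(1+σ₂) = [1]`. -/
def 𝔅 : Submodule (ZMod 2) (J K) := baseClasses F K ⊓ (LinearMap.ker B.D₂).map B.D₁

/-- `ℭ`: the classes `[f] ∈ [Fˣ]` such that some `[γ] ∈ J(K)` has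
`[γ]^(1+σ₂) = [f]` and `[γ]^(1+σ₁) = [1]`. -/
def ℭ : Submodule (ZMod 2) (J K) := baseClasses F K ⊓ (LinearMap.ker B.D₁).map B.D₂

/-- `𝔇`: the classes `[f] ∈ [Fˣ]` such that some `[γ] ∈ J(K)` has
`[γ]^(1+σ₁) = [γ]^(1+σ₂) = [f]`. -/
def 𝔇 : Submodule (ZMod 2) (J K) := baseClasses F K ⊓ (LinearMap.eqLocus B.D₁ B.D₂).map B.D₁

end Presentation

/-- `Ω⁻ⁿ` as a module over the Klein four-group: it has basis `α₁, …, αₙ, β₁, …, βₙ₊₁` (the first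
factor is spanned by the `αᵢ`, the second one by the `βᵢ`), the `βᵢ` are fixed, and
`(1 + σ₁) αᵢ = βᵢ₊₁`, `(1 + σ₂) αᵢ = βᵢ`, where `σ₁ = (1, 0)` and `σ₂ = (0, 1)`. -/
def omegaNeg (n : ℕ) :
    Representation (ZMod 2) Klein ((Fin n → ZMod 2) × (Fin (n + 1) → ZMod 2)) where
  toFun g := LinearMap.id + LinearMap.inr (ZMod 2) _ _ ∘ₗ
    (g.toAdd.1 • Fintype.linearCombination (ZMod 2)
        (fun i : Fin n => (Pi.single i.succ 1 : Fin (n + 1) → ZMod 2)) +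
      g.toAdd.2 • Fintype.linearCombination (ZMod 2)
        (fun i : Fin n => (Pi.single i.castSucc 1 : Fin (n + 1) → ZMod 2))) ∘ₗ
    LinearMap.fst (ZMod 2) _ _
  map_one' := by ext <;> simp
  map_mul' g h := by
    apply LinearMap.ext
    rintro ⟨a, b⟩
    refine Prod.ext ?_ ?_
    · simp
    · simp [add_smul]
      abel

/-- `Ω⁻ⁿ` as a module over `Gal(K/F)`. -/
abbrev Presentation.omegaNeg (B : Presentation F K) (n : ℕ) :
    Representation (ZMod 2) Gal(K/F) ((Fin n → ZMod 2) × (Fin (n + 1) → ZMod 2)) :=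
  (Biquadratic.omegaNeg n).comp B.φ.toMonoidHom

/-- The trivial one-dimensional module `𝔽₂`. -/
abbrev triv (F K : Type*) [Field F] [Field K] [Algebra F K] :
    Representation (ZMod 2) Gal(K/F) (ZMod 2) :=
  Representation.trivial (ZMod 2) Gal(K/F) (ZMod 2)

/-- Isomorphism of a submodule `X` of `J(K)` with an `𝔽₂[Gal(K/F)]`-module. -/
def IsIso (X : Subrepresentation (galJ F K)) {M : Type*} [AddCommGroup M] [Module (ZMod 2) M]
    (ρ : Representation (ZMod 2) Gal(K/F) M) : Prop :=
  Nonempty (X.toRepresentation.Equiv ρ)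

/-- The fixed part `X^G` of a submodule `X` of `J(K)`. -/
def fixedPart (X : Subrepresentation (galJ F K)) : Submodule (ZMod 2) (J K) :=
  X.toSubmodule ⊓ fixedJ F K

end Biquadratic

end

/-! Write `J K` additively and put `D₁ = 1 + σ₁`, `D₂ = 1 + σ₂`. If `x ∈ J(K)` satisfies `D₁ D₂ x =
0`, then `x`, `D₁ x`, `D₂ x` span a quotient of `Ω⁻¹`, and the norm to `F` of a representative of
`x` is a square `k²` in `K`. The norms of `D₂ x` to `K₂` and `K₃`, and of `D₁ x` to `K₁` and `K₃`,
are all represented by this `k²`, while the remaining two norms are visibly squares. So if `c` and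
`d` record the signs by which `σ₁` and `σ₂` act on `k`, then `T(D₂ x) = (0, c, c + d)` and `T(D₁ x)
= (d, 0, c + d)` (`exists_t_D₂_D₁`).

The converse `exists_of_mem_range_t` is the arithmetic heart: whenever both triples lie in `im T`,
one `x` produces them simultaneously. Hilbert 90 (`exists_mul_sq_fixed`) moves the preimages into
`K₁` and `K₂`, and `exists_common_norm` realises them, up to a factor from `F`, as the two norms of
one element. The same use of Hilbert 90 gives `ker T = [Fˣ]` (`t_eq_zero_iff`).

The rest is linear algebra over `𝔽₂`. The three nonzero pairs `(c, d)` span exactly the three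
coordinate planes, which yields `Ω⁻¹`. In dimension 1, or for a plane that is not a coordinate
plane, a linear section of `T` suffices. In dimension 3, take `x₁`, `x₂` with signs `(1, 0)`, `(0,
1)`: both `T(D₁ x₁)` and `T(D₂ x₂)` equal `(0, 0, 1)`. A class in `S` with nontrivial `T` allows a
choice with `D₁ x₁ = D₂ x₂`, and the two copies of `Ω⁻¹` are glued into `Ω⁻²`; otherwise they are
independent, and `D₁ x₁ + D₂ x₂` spans the intersection with `[Fˣ]`. -/

namespace Biquadratic

/-! ### Equivariant maps and their fixed parts -/

section Representation

open Representation

variable {k G V W : Type*} [CommRing k] [Group G] [AddCommGroup V] [Module k V]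
  [AddCommGroup W] [Module k W] {ρ : Representation k G V} {π : Representation k G W}

theorem intertwiningMap_apply (Φ : IntertwiningMap ρ π) (g : G) (v : V) :
    Φ (ρ g v) = π g (Φ v) := by
  rw [Φ.isIntertwining]

theorem mem_invariants_of_map (Φ : IntertwiningMap ρ π) {v : V} (hv : v ∈ ρ.invariants) :
    Φ v ∈ π.invariants := fun g => by
  rw [← Φ.isIntertwining, hv g]

/-- An equivariant map out of a module of Loewy length at most two is injective as soon as it is
injective on the invariants. -/
theorem injective_of_injOn_invariants (Φ : IntertwiningMap ρ π)
    (hρ : ∀ g v, ρ g v - v ∈ ρ.invariants) (hΦ : ∀ v ∈ ρ.invariants, Φ v = 0 → v = 0) :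
    Function.Injective Φ := by
  refine (injective_iff_map_eq_zero Φ.toLinearMap).2 fun v hv => ?_
  have hv : Φ v = 0 := hv
  -- For `v` in the kernel, `ρ g v - v` is invariant and also in the kernel, hence zero; so `v` is
  -- itself invariant.
  refine hΦ v (fun g => sub_eq_zero.1 (hΦ _ (hρ g v) ?_)) hv
  rw [map_sub, Φ.isIntertwining, hv, map_zero, sub_zero]

theorem nonempty_equiv_range (Φ : IntertwiningMap ρ π) (hΦ : Function.Injective Φ) :
    Nonempty (Φ.range.toRepresentation.Equiv ρ) :=
  ⟨(Representation.Equiv.mk (LinearEquiv.ofInjective Φ.toLinearMap hΦ) fun g => by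
    ext v
    exact intertwiningMap_apply Φ g v).symm⟩

theorem range_inf_invariants (Φ : IntertwiningMap ρ π) (hΦ : Function.Injective Φ) :
    Φ.range.toSubmodule ⊓ π.invariants = ρ.invariants.map Φ.toLinearMap := by
  ext w
  constructor
  · rintro ⟨⟨v, rfl⟩, hv⟩
    refine ⟨v, fun g => hΦ ?_, rfl⟩
    rw [Φ.isIntertwining]
    exact hv g
  · rintro ⟨v, hv, rfl⟩
    exact ⟨⟨v, rfl⟩, mem_invariants_of_map Φ hv⟩

end Representation

/-! ### The modules `Ω⁻ⁿ` and their maps to `J(K)` -/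

theorem add_self {V : Type*} [AddCommGroup V] [Module (ZMod 2) V] (v : V) : v + v = 0 := by
  rw [← two_smul (ZMod 2) v, show (2 : ZMod 2) = 0 from rfl, zero_smul]

theorem omegaNeg_apply (n : ℕ) (g : Klein) (v : (Fin n → ZMod 2) × (Fin (n + 1) → ZMod 2)) :
    omegaNeg n g v = v + (0,
      g.toAdd.1 • Fintype.linearCombination (ZMod 2)
        (fun i : Fin n => (Pi.single i.succ 1 : Fin (n + 1) → ZMod 2)) v.1 +
      g.toAdd.2 • Fintype.linearCombination (ZMod 2)
        (fun i : Fin n => (Pi.single i.castSucc 1 : Fin (n + 1) → ZMod 2)) v.1) := rfl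

theorem linearCombination_single_succ {n : ℕ} (a : Fin n → ZMod 2) (i : Fin n) :
    Fintype.linearCombination (ZMod 2)
      (fun i : Fin n => (Pi.single i.succ 1 : Fin (n + 1) → ZMod 2)) a i.succ = a i := by
  simp [Fintype.linearCombination_apply, Finset.sum_apply, Pi.single_apply, Fin.succ_inj]

theorem mem_invariants_omegaNeg_iff {n : ℕ}
    {v : (Fin n → ZMod 2) × (Fin (n + 1) → ZMod 2)} :
    v ∈ (omegaNeg n).invariants ↔ v.1 = 0 := by
  constructor
  · intro hv
    -- `σ₁` alone detects the `α`-part, since the `(1 + σ₁) αᵢ = βᵢ₊₁` are independent.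
    have h := hv (Multiplicative.ofAdd (1, 0))
    rw [omegaNeg_apply, add_eq_left] at h
    have h2 := (Prod.ext_iff.1 h).2
    ext i
    have h3 := congr_fun h2 i.succ
    simpa [linearCombination_single_succ] using h3
  · intro hv g
    rw [omegaNeg_apply, hv]
    simp

theorem omegaNeg_sub_mem_invariants {n : ℕ} (g : Klein)
    (v : (Fin n → ZMod 2) × (Fin (n + 1) → ZMod 2)) :
    omegaNeg n g v - v ∈ (omegaNeg n).invariants := by
  rw [mem_invariants_omegaNeg_iff, omegaNeg_apply, add_sub_cancel_left]

namespace Presentation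

variable {F K : Type*} [Field F] [Field K] [Algebra F K] (B : Presentation F K)

theorem gal_cases (g : Gal(K/F)) : g = 1 ∨ g = B.σ₁ ∨ g = B.σ₂ ∨ g = B.σ₁ * B.σ₂ := by
  obtain ⟨x, rfl⟩ := B.φ.symm.surjective g
  have hx : ∀ x : Klein, x = 1 ∨ x = .ofAdd (1, 0) ∨ x = .ofAdd (0, 1) ∨
    x = .ofAdd (1, 0) * .ofAdd (0, 1) := by decide
  rcases hx x with rfl | rfl | rfl | rfl
  · exact .inl (map_one _)
  · exact .inr (.inl rfl)
  · exact .inr (.inr (.inl rfl))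
  · exact .inr (.inr (.inr (map_mul _ _ _)))

theorem mem_invariants_omegaNeg_iff {n : ℕ}
    {v : (Fin n → ZMod 2) × (Fin (n + 1) → ZMod 2)} :
    v ∈ (B.omegaNeg n).invariants ↔ v.1 = 0 := by
  rw [← Biquadratic.mem_invariants_omegaNeg_iff]
  exact ⟨fun h g => by simpa using h (B.φ.symm g), fun h g => h (B.φ g)⟩

theorem omegaNeg_sub_mem_invariants {n : ℕ} (g : Gal(K/F))
    (v : (Fin n → ZMod 2) × (Fin (n + 1) → ZMod 2)) :
    B.omegaNeg n g v - v ∈ (B.omegaNeg n).invariants :=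
  B.mem_invariants_omegaNeg_iff.2
    (Biquadratic.mem_invariants_omegaNeg_iff.1 (Biquadratic.omegaNeg_sub_mem_invariants _ v))

/-- A linear map that commutes with `σ₁` and `σ₂` is equivariant. -/
noncomputable def intertwiningMap {V : Type*} [AddCommGroup V] [Module (ZMod 2) V]
    {ρ : Representation (ZMod 2) Gal(K/F) V} (f : V →ₗ[ZMod 2] J K)
    (h₁ : ∀ v, f (ρ B.σ₁ v) = galJ F K B.σ₁ (f v))
    (h₂ : ∀ v, f (ρ B.σ₂ v) = galJ F K B.σ₂ (f v)) :
    Representation.IntertwiningMap ρ (galJ F K) where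
  toLinearMap := f
  isIntertwining' g := by
    ext v
    rcases B.gal_cases g with rfl | rfl | rfl | rfl
    · simp
    · exact h₁ v
    · exact h₂ v
    · simp only [map_mul, LinearMap.comp_apply, Module.End.mul_apply]
      rw [h₁, h₂]

theorem galJ_σ₁ (x : J K) : galJ F K B.σ₁ x = x + B.D₁ x := by
  change _ = x + (x + _)
  rw [← add_assoc, add_self, zero_add]

theorem galJ_σ₂ (x : J K) : galJ F K B.σ₂ x = x + B.D₂ x := by
  change _ = x + (x + _)
  rw [← add_assoc, add_self, zero_add]

theorem mem_fixedJ_iff {x : J K} : x ∈ fixedJ F K ↔ B.D₁ x = 0 ∧ B.D₂ x = 0 := by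
  constructor
  · intro h
    have h1 := h B.σ₁
    have h2 := h B.σ₂
    rw [galJ_σ₁, add_eq_left] at h1
    rw [galJ_σ₂, add_eq_left] at h2
    exact ⟨h1, h2⟩
  · rintro ⟨h1, h2⟩ g
    rw [← add_eq_left (a := x), ← galJ_σ₁] at h1
    rw [← add_eq_left (a := x), ← galJ_σ₂] at h2
    rcases B.gal_cases g with rfl | rfl | rfl | rfl
    · simp
    · exact h1
    · exact h2
    · rw [map_mul, Module.End.mul_apply, h2, h1]

theorem D₁_D₁ (x : J K) : B.D₁ (B.D₁ x) = 0 := by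
  have h : galJ F K B.σ₁ (galJ F K B.σ₁ x) = x := by
    rw [← Module.End.mul_apply, ← map_mul, ← sq, B.symm_sq, map_one]; rfl
  change (x + _) + galJ F K B.σ₁ (x + _) = 0
  rw [map_add, h, add_comm (galJ F K B.σ₁ x), add_self]

theorem D₂_D₂ (x : J K) : B.D₂ (B.D₂ x) = 0 := by
  have h : galJ F K B.σ₂ (galJ F K B.σ₂ x) = x := by
    rw [← Module.End.mul_apply, ← map_mul, ← sq, B.symm_sq, map_one]; rfl
  change (x + _) + galJ F K B.σ₂ (x + _) = 0
  rw [map_add, h, add_comm (galJ F K B.σ₂ x), add_self]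

theorem σ₂_mul_σ₁ : B.σ₂ * B.σ₁ = B.σ₁ * B.σ₂ := by
  rw [← map_mul, mul_comm, map_mul]

theorem D₂_D₁ (x : J K) : B.D₂ (B.D₁ x) = B.D₁ (B.D₂ x) := by
  have h : galJ F K B.σ₂ (galJ F K B.σ₁ x) = galJ F K B.σ₁ (galJ F K B.σ₂ x) := by
    rw [← Module.End.mul_apply, ← map_mul (galJ F K), σ₂_mul_σ₁, map_mul (galJ F K),
      Module.End.mul_apply]
  change (x + _) + galJ F K B.σ₂ (x + _) = (x + _) + galJ F K B.σ₁ (x + _)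
  rw [map_add, map_add, h]
  abel

/-- `D₁` and `D₂` square to zero and commute, so `D₁ D₂ x = 0` is all that is needed for `x` to
generate an image of `Ω⁻¹`. -/
theorem D₁_mem_fixedJ {x : J K} (hx : B.D₁ (B.D₂ x) = 0) : B.D₁ x ∈ fixedJ F K :=
  B.mem_fixedJ_iff.2 ⟨B.D₁_D₁ x, by rw [D₂_D₁, hx]⟩

theorem D₂_mem_fixedJ {x : J K} (hx : B.D₁ (B.D₂ x) = 0) : B.D₂ x ∈ fixedJ F K :=
  B.mem_fixedJ_iff.2 ⟨hx, B.D₂_D₂ x⟩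

/-- The map from `Ω⁻ⁿ` that is given by images of `αᵢ` and `βᵢ` satisfying the defining
relations. -/
noncomputable def omegaMap {n : ℕ} (α : Fin n → J K) (β : Fin (n + 1) → J K)
    (hβ : ∀ i, β i ∈ fixedJ F K) (h₁ : ∀ i, B.D₁ (α i) = β i.succ)
    (h₂ : ∀ i, B.D₂ (α i) = β i.castSucc) :
    Representation.IntertwiningMap (B.omegaNeg n) (galJ F K) :=
  B.intertwiningMap
    ((Fintype.linearCombination (ZMod 2) α).coprod (Fintype.linearCombination (ZMod 2) β))
    (fun v => by
      have h : B.D₁ (Fintype.linearCombination (ZMod 2) β v.2) = 0 := by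
        simp only [Fintype.linearCombination_apply, map_sum, map_smul,
          (B.mem_fixedJ_iff.1 (hβ _)).1, smul_zero, Finset.sum_const_zero]
      have h' : B.omegaNeg n B.σ₁ v = _ := omegaNeg_apply n _ v
      rw [h', galJ_σ₁, map_add, LinearMap.coprod_apply, map_add B.D₁, h]
      simp [Fintype.linearCombination_apply, map_sum, ← h₁])
    (fun v => by
      have h : B.D₂ (Fintype.linearCombination (ZMod 2) β v.2) = 0 := by
        simp only [Fintype.linearCombination_apply, map_sum, map_smul,
          (B.mem_fixedJ_iff.1 (hβ _)).2, smul_zero, Finset.sum_const_zero]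
      have h' : B.omegaNeg n B.σ₂ v = _ := omegaNeg_apply n _ v
      rw [h', galJ_σ₂, map_add, LinearMap.coprod_apply, map_add B.D₂, h]
      simp [Fintype.linearCombination_apply, map_sum, ← h₂])

theorem omegaMap_apply {n : ℕ} (α : Fin n → J K) (β : Fin (n + 1) → J K)
    (hβ : ∀ i, β i ∈ fixedJ F K) (h₁ : ∀ i, B.D₁ (α i) = β i.succ)
    (h₂ : ∀ i, B.D₂ (α i) = β i.castSucc) (v) (hv : v.1 = 0) :
    B.omegaMap α β hβ h₁ h₂ v = ∑ i, v.2 i • β i := by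
  change Fintype.linearCombination (ZMod 2) α v.1 + Fintype.linearCombination (ZMod 2) β v.2 = _
  rw [hv, map_zero, zero_add, Fintype.linearCombination_apply]

/-- The map from `Ω⁻¹` generated by one class. -/
noncomputable def omegaMapOne {x : J K} (hx : B.D₁ (B.D₂ x) = 0) :
    Representation.IntertwiningMap (B.omegaNeg 1) (galJ F K) :=
  B.omegaMap ![x] ![B.D₂ x, B.D₁ x]
    (Fin.forall_fin_two.2 ⟨B.D₂_mem_fixedJ hx, B.D₁_mem_fixedJ hx⟩)
    (fun i => by fin_cases i; rfl) (fun i => by fin_cases i; rfl)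

theorem omegaMapOne_apply {x : J K} (hx : B.D₁ (B.D₂ x) = 0) {v}
    (hv : v ∈ (B.omegaNeg 1).invariants) :
    B.omegaMapOne hx v = v.2 0 • B.D₂ x + v.2 1 • B.D₁ x := by
  refine (B.omegaMap_apply _ _ _ _ _ v (B.mem_invariants_omegaNeg_iff.1 hv)).trans ?_
  rw [Fin.sum_univ_two]
  rfl

end Presentation

end Biquadratic

namespace Biquadratic

variable {F K : Type*} [Field F] [Field K] [Algebra F K]

/-! ### Norms and square classes over the fixed field of an involution -/

theorem cls_eq_of_mul_sq {L : Type*} [Field L] {u v w : Lˣ} (h : u * w ^ 2 = v) :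
    cls u = cls v := by
  rw [← h, cls_mul, (cls_eq_zero_iff (w ^ 2)).2 ⟨w, rfl⟩, add_zero]

theorem galJ_cls (g : Gal(K/F)) (u : Kˣ) :
    galJ F K g (cls u) = cls (Units.map (g : K →* K) u) := rfl

/-- `τ` is an involution of `K / F` whose fixed field is `E`. -/
structure IsInvolutionOver (E : IntermediateField F K) (τ : Gal(K/F)) : Prop where
  apply_apply : ∀ x, τ (τ x) = x
  exists_neg : ∃ r : K, r ≠ 0 ∧ τ r = -r
  mem_iff : ∀ y, y ∈ E ↔ τ y = y
  eq_one_or : ∀ g : Gal(K/F), (∀ y ∈ E, g y = y) → g = 1 ∨ g = τ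

namespace IsInvolutionOver

variable {E : IntermediateField F K} {τ : Gal(K/F)}

theorem ne_one (h : IsInvolutionOver E τ) (hchar : (2 : K) ≠ 0) : τ ≠ 1 := by
  rintro rfl
  obtain ⟨r, hr, h1⟩ := h.exists_neg
  rw [AlgEquiv.one_apply, eq_neg_iff_add_eq_zero, ← two_mul] at h1
  exact (mul_ne_zero hchar hr) h1

theorem coe_norm [IsGalois F K] [FiniteDimensional F K]
    (h : IsInvolutionOver E τ) (hchar : (2 : K) ≠ 0) (x : K) :
    (Algebra.norm E x : K) = x * τ x := by
  classical
  let τ' : Gal(K/E) := { τ with commutes' := fun y => (h.mem_iff _).1 y.2 }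
  have hne : (1 : Gal(K/E)) ≠ τ' := by
    intro h1
    apply h.ne_one hchar
    ext z
    exact (DFunLike.congr_fun h1 z).symm
  have huniv : (Finset.univ : Finset Gal(K/E)) = {1, τ'} := by
    symm
    rw [Finset.eq_univ_iff_forall]
    intro g
    rw [Finset.mem_insert, Finset.mem_singleton]
    rcases h.eq_one_or (g.restrictScalars F) (fun y hy => g.commutes ⟨y, hy⟩) with h1 | h1
    · left
      ext z
      exact DFunLike.congr_fun h1 z
    · right
      ext z
      exact DFunLike.congr_fun h1 z
  have := Algebra.norm_eq_prod_automorphisms E x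
  rw [huniv, Finset.prod_pair hne] at this
  exact this

theorem incl_normJ [IsGalois F K] [FiniteDimensional F K]
    (h : IsInvolutionOver E τ) (hchar : (2 : K) ≠ 0) (x : J K) :
    incl E K (normJ E K x) = x + galJ F K τ x := by
  obtain ⟨u, rfl⟩ := cls_surjective x
  rw [galJ_cls, ← cls_mul]
  change cls _ = _
  congr 1
  ext
  exact h.coe_norm hchar u

/-- The norm `u τ(u)` is a square in `E` exactly when its square root `κ` in `K` lies in `E`, as the
other root is `-κ`. This turns each coordinate of `T` into a sign. -/
theorem normJ_cls_eq_zero_iff [IsGalois F K] [FiniteDimensional F K]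
    (h : IsInvolutionOver E τ) (hchar : (2 : K) ≠ 0)
    {u : Kˣ} {κ : K} (hκ : κ ^ 2 = u * τ u) : normJ E K (cls u) = 0 ↔ τ κ = κ := by
  have hN := h.coe_norm hchar (u : K)
  rw [normJ, mapJ_cls, cls_eq_zero_iff, ← h.mem_iff]
  constructor
  · rintro ⟨y, hy⟩
    have hy' : (((y : E) : K)) ^ 2 = κ ^ 2 := by
      rw [hκ, ← hN]
      exact congrArg (fun z : Eˣ => ((z : E) : K)) hy
    rcases sq_eq_sq_iff_eq_or_eq_neg.1 hy' with h1 | h1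
    · exact h1 ▸ (y : E).2
    · have := neg_mem (y : E).2
      rwa [h1, neg_neg] at this
  · intro hmem
    have h0 : (⟨κ, hmem⟩ : E) ≠ 0 := by
      intro h0
      have : κ = 0 := congrArg Subtype.val h0
      rw [this, zero_pow two_ne_zero] at hκ
      exact mul_ne_zero u.ne_zero (by simp) hκ.symm
    refine ⟨Units.mk0 _ h0, ?_⟩
    ext
    change κ ^ 2 = (Algebra.norm E (u : K) : K)
    rw [hN, hκ]

/-- Kummer theory for `K / E`: if `y² ∈ E` then `τ y = ±y`, so either `y ∈ E` or `y / r ∈ E`. The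
nontrivial class is that of `r²`. -/
theorem card_relSq (h : IsInvolutionOver E τ) (hchar : (2 : K) ≠ 0) : Nat.card (relSq E K) = 2 := by
  obtain ⟨r, hr, hτr⟩ := h.exists_neg
  have hmem : r ^ 2 ∈ E := by
    rw [h.mem_iff, map_pow, hτr, neg_sq]
  have h0 : (⟨r ^ 2, hmem⟩ : E) ≠ 0 := fun h0 =>
    pow_ne_zero 2 hr (congrArg Subtype.val h0)
  let a : Eˣ := Units.mk0 _ h0
  have ha : cls a ∈ relSq E K := by
    rw [LinearMap.mem_ker, incl, mapJ_cls, cls_eq_zero_iff]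
    exact ⟨Units.mk0 r hr, by ext; rfl⟩
  have ha0 : cls a ≠ 0 := by
    rw [Ne, cls_eq_zero_iff]
    rintro ⟨y, hy⟩
    have hy' : (((y : E) : K)) ^ 2 = r ^ 2 := congrArg (fun z : Eˣ => ((z : E) : K)) hy
    have hrE : r ∈ E := by
      rcases sq_eq_sq_iff_eq_or_eq_neg.1 hy' with h1 | h1
      · exact h1 ▸ (y : E).2
      · have := neg_mem (y : E).2
        rwa [h1, neg_neg] at this
    rw [h.mem_iff, hτr, eq_comm, eq_neg_iff_add_eq_zero, ← two_mul] at hrE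
    exact mul_ne_zero hchar hr hrE
  rw [Nat.card_eq_two_iff]
  refine ⟨0, ⟨cls a, ha⟩, fun hh => ha0 (congrArg Subtype.val hh).symm, ?_⟩
  rw [Set.eq_univ_iff_forall]
  rintro ⟨x, hx⟩
  obtain ⟨u, rfl⟩ := cls_surjective x
  have hx' := hx
  rw [LinearMap.mem_ker, incl, mapJ_cls, cls_eq_zero_iff] at hx'
  obtain ⟨y, hy⟩ := hx'
  have hy' : (y : K) ^ 2 = ((u : E) : K) := congrArg (fun z : Kˣ => (z : K)) hy
  have h2 : (τ y) ^ 2 = (y : K) ^ 2 := by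
    rw [← map_pow, hy', (h.mem_iff _).1 (u : E).2]
  rw [Set.mem_insert_iff, Set.mem_singleton_iff]
  rcases sq_eq_sq_iff_eq_or_eq_neg.1 h2 with h1 | h1
  · left
    refine Subtype.ext ((cls_eq_zero_iff u).2 ?_)
    have hyE := (h.mem_iff _).2 h1
    refine ⟨Units.mk0 ⟨y, hyE⟩ fun h => y.ne_zero (congrArg Subtype.val h), ?_⟩
    ext
    exact hy'
  · right
    refine Subtype.ext ?_
    have hyE : (y : K) / r ∈ E := by
      rw [h.mem_iff, map_div₀, h1, hτr, neg_div_neg_eq]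
    refine (cls_eq_of_mul_sq (w := Units.mk0 ⟨y / r, hyE⟩ fun h =>
      div_ne_zero y.ne_zero hr (congrArg Subtype.val h)) ?_).symm
    ext
    change r ^ 2 * ((y : K) / r) ^ 2 = ((u : E) : K)
    rw [← hy']
    field_simp

end IsInvolutionOver

namespace Presentation

variable (B : Presentation F K)

/-! ### The three involutions, Hilbert 90 and common norms -/

theorem finiteDimensional (B : Presentation F K) [IsGalois F K] : FiniteDimensional F K := by
  have h : FiniteDimensional F (⊤ : IntermediateField F K) := by
    rw [← B.adjoin_eq_top]
    have : Finite ({B.r₁, B.r₂} : Set K) := Set.toFinite _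
    exact IntermediateField.finiteDimensional_adjoin fun x _ => Algebra.IsIntegral.isIntegral x
  exact Module.Finite.equiv (IntermediateField.topEquiv (F := F) (E := K)).toLinearEquiv

theorem eq_one_of_fix {g : Gal(K/F)} (h₁ : g B.r₁ = B.r₁) (h₂ : g B.r₂ = B.r₂) : g = 1 := by
  have h : IntermediateField.adjoin F {B.r₁, B.r₂} ≤
      IntermediateField.fixedField (Subgroup.zpowers g) := by
    rw [IntermediateField.adjoin_le_iff]
    have aux : ∀ x, g x = x → x ∈ IntermediateField.fixedField (Subgroup.zpowers g) := by
      intro x hx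
      rw [IntermediateField.mem_fixedField_iff]
      intro f hf
      have : Subgroup.zpowers g ≤ MulAction.stabilizer Gal(K/F) x := by
        rw [Subgroup.zpowers_le]
        exact hx
      exact this hf
    rintro x (rfl | rfl)
    · exact aux _ h₁
    · exact aux _ h₂
  rw [B.adjoin_eq_top] at h
  ext x
  exact (IntermediateField.mem_fixedField_iff _ _).1 (h (IntermediateField.mem_top (x := x))) g
    (Subgroup.mem_zpowers g)

theorem r₁_ne_zero : B.r₁ ≠ 0 := by
  intro h
  refine B.symm_ne_one (g := Multiplicative.ofAdd (1, 0)) (by decide)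
    (B.eq_one_of_fix ?_ B.σ₁_r₂)
  rw [h, map_zero]

theorem r₂_ne_zero : B.r₂ ≠ 0 := by
  intro h
  refine B.symm_ne_one (g := Multiplicative.ofAdd (0, 1)) (by decide)
    (B.eq_one_of_fix B.σ₂_r₁ ?_)
  rw [h, map_zero]

theorem σ₁_σ₁ (x : K) : B.σ₁ (B.σ₁ x) = x := by
  rw [← AlgEquiv.mul_apply, ← sq, B.symm_sq, AlgEquiv.one_apply]

theorem σ₂_σ₂ (x : K) : B.σ₂ (B.σ₂ x) = x := by
  rw [← AlgEquiv.mul_apply, ← sq, B.symm_sq, AlgEquiv.one_apply]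

theorem σ₂_σ₁ (x : K) : B.σ₂ (B.σ₁ x) = B.σ₁ (B.σ₂ x) := by
  rw [← AlgEquiv.mul_apply, σ₂_mul_σ₁, AlgEquiv.mul_apply]

theorem isInvolutionOver (B : Presentation F K) [IsGalois F K] {r s : K} {τ : Gal(K/F)}
    (hττ : ∀ x, τ (τ x) = x) (hr : τ r = r) (hs : s ≠ 0) (hs' : τ s = -s)
    (hg : ∀ g : Gal(K/F), g r = r → g = 1 ∨ g = τ) :
    IsInvolutionOver F⟮r⟯ τ := by
  have := B.finiteDimensional
  have hmem : ∀ g : Gal(K/F), g r = r → ∀ y ∈ F⟮r⟯, g y = y := by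
    intro g hgr y hy
    have hle : F⟮r⟯ ≤ IntermediateField.fixedField (Subgroup.zpowers g) := by
      rw [IntermediateField.adjoin_simple_le_iff, IntermediateField.mem_fixedField_iff]
      intro f hf
      have : Subgroup.zpowers g ≤ MulAction.stabilizer Gal(K/F) r := by
        rw [Subgroup.zpowers_le]
        exact hgr
      exact this hf
    exact (IntermediateField.mem_fixedField_iff _ _).1 (hle hy) g (Subgroup.mem_zpowers g)
  refine ⟨hττ, ⟨s, hs, hs'⟩, fun y => ⟨hmem τ hr y, fun hy => ?_⟩, fun g h =>
    hg g (h r (IntermediateField.mem_adjoin_simple_self F r))⟩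
  rw [← IsGalois.fixedField_fixingSubgroup F⟮r⟯, IntermediateField.mem_fixedField_iff]
  intro g hgE
  rcases hg g ((IntermediateField.mem_fixingSubgroup_iff _ _).1 hgE r
    (IntermediateField.mem_adjoin_simple_self F r)) with rfl | rfl
  · rfl
  · exact hy

theorem ne_neg_self (hchar : (2 : K) ≠ 0) {x : K} (hx : x ≠ 0) : -x ≠ x := fun h => by
  rw [eq_comm, eq_neg_iff_add_eq_zero, ← two_mul] at h
  exact mul_ne_zero hchar hx h

theorem isInvolutionOver_K₁ [IsGalois F K] (hchar : (2 : K) ≠ 0) :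
    IsInvolutionOver B.K₁ B.σ₂ := by
  have h := ne_neg_self hchar B.r₁_ne_zero
  refine B.isInvolutionOver B.σ₂_σ₂ B.σ₂_r₁ B.r₂_ne_zero B.σ₂_r₂ fun g hg => ?_
  rcases B.gal_cases g with rfl | rfl | rfl | rfl
  · exact .inl rfl
  · exact absurd (B.σ₁_r₁.symm.trans hg) h
  · exact .inr rfl
  · rw [AlgEquiv.mul_apply, B.σ₂_r₁, B.σ₁_r₁] at hg
    exact absurd hg h

theorem isInvolutionOver_K₂ [IsGalois F K] (hchar : (2 : K) ≠ 0) :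
    IsInvolutionOver B.K₂ B.σ₁ := by
  have h := ne_neg_self hchar B.r₂_ne_zero
  refine B.isInvolutionOver B.σ₁_σ₁ B.σ₁_r₂ B.r₁_ne_zero B.σ₁_r₁ fun g hg => ?_
  rcases B.gal_cases g with rfl | rfl | rfl | rfl
  · exact .inl rfl
  · exact .inr rfl
  · exact absurd (B.σ₂_r₂.symm.trans hg) h
  · rw [AlgEquiv.mul_apply, B.σ₂_r₂, map_neg, B.σ₁_r₂] at hg
    exact absurd hg h

theorem isInvolutionOver_K₃ [IsGalois F K] (hchar : (2 : K) ≠ 0) :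
    IsInvolutionOver B.K₃ (B.σ₁ * B.σ₂) := by
  have h := ne_neg_self hchar (mul_ne_zero B.r₁_ne_zero B.r₂_ne_zero)
  refine B.isInvolutionOver (fun x => ?_) ?_ B.r₁_ne_zero ?_ fun g hg => ?_
  · rw [AlgEquiv.mul_apply, AlgEquiv.mul_apply, σ₂_σ₁, σ₂_σ₂, σ₁_σ₁]
  · rw [AlgEquiv.mul_apply, map_mul, map_mul, B.σ₂_r₁, B.σ₂_r₂, B.σ₁_r₁, map_neg, B.σ₁_r₂,
      neg_mul_neg]
  · rw [AlgEquiv.mul_apply, B.σ₂_r₁, B.σ₁_r₁]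
  · rcases B.gal_cases g with rfl | rfl | rfl | rfl
    · exact .inl rfl
    · rw [map_mul, B.σ₁_r₁, B.σ₁_r₂, neg_mul] at hg
      exact absurd hg h
    · rw [map_mul, B.σ₂_r₁, B.σ₂_r₂, mul_neg] at hg
      exact absurd hg h
    · exact .inr rfl

theorem exists_of_fixed [IsGalois F K] {x : K} (h₁ : B.σ₁ x = x) (h₂ : B.σ₂ x = x) :
    ∃ f : F, algebraMap F K f = x := by
  have := B.finiteDimensional
  refine (IsGalois.mem_range_algebraMap_iff_fixed (F := F) x).2 fun g => ?_
  rcases B.gal_cases g with rfl | rfl | rfl | rfl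
  · rfl
  · exact h₁
  · exact h₂
  · rw [AlgEquiv.mul_apply, h₂, h₁]

theorem mem_baseClasses_of_fixed [IsGalois F K] {u : Kˣ} (h₁ : B.σ₁ (u : K) = u)
    (h₂ : B.σ₂ (u : K) = u) : cls u ∈ baseClasses F K := by
  obtain ⟨f, hf⟩ := B.exists_of_fixed h₁ h₂
  have hf0 : f ≠ 0 := by
    rintro rfl
    exact u.ne_zero (by rw [← hf, map_zero])
  refine ⟨cls (Units.mk0 f hf0), ?_⟩
  rw [incl, mapJ_cls]
  congr 1
  ext
  exact hf

/-- Hilbert 90 for an involution `τ`: if `u τ(u)` is the square of a fixed element of `τ`, then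
the square class of `u` is represented by a fixed element of `τ`. -/
theorem exists_mul_sq_fixed {τ : Gal(K/F)} {r : K} (hr : r ≠ 0)
    (hr' : τ r = -r) {u k : K} (hu : u ≠ 0) (hk : k ^ 2 = u * τ u) (hτk : τ k = k) :
    ∃ w : K, w ≠ 0 ∧ τ (u * w ^ 2) = u * w ^ 2 ∧
      ∀ g : Gal(K/F), g u = u → g k = k → g r = r → g w = w := by
  have hk0 : k ≠ 0 := by
    rintro rfl
    rw [zero_pow two_ne_zero] at hk
    exact mul_ne_zero hu (by simpa using hu) hk.symm
  have hτu : τ u = k ^ 2 / u := by rw [hk]; field_simp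
  by_cases h : u + k = 0
  · have hu' : u = -k := eq_neg_of_add_eq_zero_left h
    refine ⟨r, hr, ?_, fun g _ _ h => h⟩
    rw [map_mul, map_pow, hr', hu', map_neg, hτk, neg_sq]
  · refine ⟨(u + k) / u, div_ne_zero h hu, ?_, fun g h1 h2 _ => ?_⟩
    · rw [map_mul, map_pow, map_div₀, map_add, hτk, hτu]
      field_simp
      ring
    · rw [map_div₀, map_add, h1, h2]

/-- Elements `c` of `K₁` and `d` of `K₂` with equal norms to `F` become norms of one element
of `K` after multiplication by one element of `F`. -/
theorem exists_common_norm {c d : K} (hc : c ≠ 0)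
    (hc₂ : B.σ₂ c = c) (hd₁ : B.σ₁ d = d) (h : c * B.σ₁ c = d * B.σ₂ d) :
    ∃ x f : K, x ≠ 0 ∧ f ≠ 0 ∧ B.σ₁ f = f ∧ B.σ₂ f = f ∧
      x * B.σ₂ x = c * f ∧ x * B.σ₁ x = d * f := by
  have h21 : B.σ₂ (B.σ₁ c) = B.σ₁ c := by rw [σ₂_σ₁, hc₂]
  have h12 : B.σ₁ (B.σ₂ d) = B.σ₂ d := by rw [← σ₂_σ₁, hd₁]
  -- The candidate is `x = c + d`: equality of the norms of `c` and `d` makes the sum of their two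
  -- traces factor out of both products, and this sum serves as `f`.
  have e₂ : (c + d) * B.σ₂ (c + d) = c * (c + B.σ₁ c + d + B.σ₂ d) := by
    rw [map_add, hc₂]
    linear_combination -h
  have e₁ : (c + d) * B.σ₁ (c + d) = d * (c + B.σ₁ c + d + B.σ₂ d) := by
    rw [map_add, hd₁]
    linear_combination h
  by_cases hf : c + B.σ₁ c + d + B.σ₂ d = 0
  · rw [hf, mul_zero, mul_eq_zero, map_add, hc₂] at e₂
    have hc₁ : B.σ₁ c = c := by
      rcases e₂ with h1 | h1
      · rw [eq_neg_of_add_eq_zero_left h1, map_neg, hd₁]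
      · rw [eq_neg_of_add_eq_zero_left h1, map_neg, h12]
    have hdc : d = -c := by
      rcases e₂ with h1 | h1
      · exact eq_neg_of_add_eq_zero_right h1
      · rw [hc₁] at hf
        linear_combination hf - h1
    -- When the traces cancel, `c` lies in `F` and `d = -c`. Then `r₁` works, since its products
    -- with its `σ₂`- and `σ₁`-conjugates are `r₁²` and `-r₁²`.
    have hr : B.r₁ ^ 2 / c ≠ 0 := div_ne_zero (pow_ne_zero 2 B.r₁_ne_zero) hc
    refine ⟨B.r₁, B.r₁ ^ 2 / c, B.r₁_ne_zero, hr, ?_, ?_, ?_, ?_⟩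
    · rw [map_div₀, map_pow, B.σ₁_r₁, hc₁, neg_sq]
    · rw [map_div₀, map_pow, B.σ₂_r₁, hc₂]
    · rw [B.σ₂_r₁]; field_simp
    · rw [B.σ₁_r₁, hdc]; field_simp
  · refine ⟨c + d, _, ?_, hf, ?_, ?_, e₂, e₁⟩
    · intro h0
      rw [h0, zero_mul] at e₂
      exact mul_ne_zero hc hf e₂.symm
    · simp only [map_add, σ₁_σ₁, hd₁, h12]; ring
    · simp only [map_add, σ₂_σ₂, hc₂, h21]; ring

end Presentation

end Biquadratic

namespace Biquadratic

variable {F K : Type*} [Field F] [Field K] [Algebra F K]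

/-! ### The map `T` in coordinates -/

theorem nonempty_linearEquiv_of_card_eq_two {V : Type*} [AddCommGroup V] [Module (ZMod 2) V]
    (h : Nat.card V = 2) : Nonempty (V ≃ₗ[ZMod 2] ZMod 2) := by
  have : Finite V := Nat.finite_of_card_ne_zero (by rw [h]; exact two_ne_zero)
  have h1 : Nat.card V = Nat.card (ZMod 2) ^ Module.finrank (ZMod 2) V :=
    Module.natCard_eq_pow_finrank
  rw [h, Nat.card_zmod] at h1
  refine ⟨LinearEquiv.ofFinrankEq _ _ ?_⟩
  rw [Module.finrank_self]
  exact Nat.pow_right_injective le_rfl (by simpa using h1.symm)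

theorem zmod_two_eq_of_iff {a b : ZMod 2} (h : a = 0 ↔ b = 0) : a = b := by
  revert a b
  decide

/-- A coordinate on the group `(Eˣ ∩ Kˣ²) / Eˣ²` of order two. -/
noncomputable def IsInvolutionOver.relSqEquiv {E : IntermediateField F K} {τ : Gal(K/F)}
    (h : IsInvolutionOver E τ) (hchar : (2 : K) ≠ 0) : relSq E K ≃ₗ[ZMod 2] ZMod 2 :=
  (nonempty_linearEquiv_of_card_eq_two (h.card_relSq hchar)).some

namespace Presentation

variable (B : Presentation F K)

theorem baseClasses_le_fixedJ : baseClasses F K ≤ fixedJ F K := by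
  rintro _ ⟨x, rfl⟩ g
  obtain ⟨u, rfl⟩ := cls_surjective x
  rw [incl, mapJ_cls, galJ_cls]
  congr 1
  ext
  exact g.commutes u

theorem D₁_cls (u : Kˣ) : B.D₁ (cls u) = cls (u * Units.map (B.σ₁ : K →* K) u) := rfl

theorem D₂_cls (u : Kˣ) : B.D₂ (cls u) = cls (u * Units.map (B.σ₂ : K →* K) u) := rfl

/-- On a `k` whose square is fixed, the group acts through signs, and these multiply; written
additively, the sign of `σ₁ σ₂` is `c + d`. -/
theorem exists_signs {k : K} (h₁ : B.σ₁ (k ^ 2) = k ^ 2)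
    (h₂ : B.σ₂ (k ^ 2) = k ^ 2) : ∃ c d : ZMod 2, (B.σ₁ k = k ↔ c = 0) ∧ (B.σ₂ k = k ↔ d = 0) ∧
      ((B.σ₁ * B.σ₂) k = k ↔ c + d = 0) := by
  classical
  rw [AlgEquiv.mul_apply]
  rw [map_pow, sq_eq_sq_iff_eq_or_eq_neg] at h₁ h₂
  refine ⟨if B.σ₁ k = k then 0 else 1, if B.σ₂ k = k then 0 else 1, by simp, by simp, ?_⟩
  -- This covers `k = 0` and characteristic 2, which are not excluded here; all signs are then
  -- trivial.
  by_cases hk : -k = k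
  · have h₁' : B.σ₁ k = k := h₁.elim id fun h => h.trans hk
    have h₂' : B.σ₂ k = k := h₂.elim id fun h => h.trans hk
    simp [h₁', h₂']
  · have hk' : k ≠ -k := fun h => hk h.symm
    rcases h₁ with h₁ | h₁ <;> rcases h₂ with h₂ | h₂ <;> simp [h₁, h₂, hk]
    rfl

theorem exists_sq_of_mem_fixedJ {u : Kˣ} (hu : cls u ∈ fixedJ F K) (g : Gal(K/F)) :
    ∃ k : K, k ^ 2 = u * g u := by
  have h := hu g
  rw [← sub_eq_zero, sub_eq_add_neg, ← add_right_inj (cls u), galJ_cls, add_comm, add_assoc,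
    neg_add_cancel, add_zero, add_zero] at h
  have h2 : cls (u * Units.map (g : K →* K) u) = 0 := by
    rw [cls_mul, h, add_self]
  obtain ⟨k, hk⟩ := (cls_eq_zero_iff _).1 h2
  exact ⟨k, congrArg (fun z : Kˣ => (z : K)) hk⟩

variable [IsGalois F K]

/-- Coordinates on the target of `T`. -/
noncomputable def targetEquiv (hchar : (2 : K) ≠ 0) :
    (relSq B.K₁ K × relSq B.K₂ K × relSq B.K₃ K) ≃ₗ[ZMod 2] ZMod 2 × ZMod 2 × ZMod 2 :=
  ((B.isInvolutionOver_K₁ hchar).relSqEquiv hchar).prodCongr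
    (((B.isInvolutionOver_K₂ hchar).relSqEquiv hchar).prodCongr
      ((B.isInvolutionOver_K₃ hchar).relSqEquiv hchar))

/-- The map `T` in coordinates. -/
noncomputable def t (hchar : (2 : K) ≠ 0) : fixedJ F K →ₗ[ZMod 2] ZMod 2 × ZMod 2 × ZMod 2 :=
  (B.targetEquiv hchar : _ →ₗ[ZMod 2] _) ∘ₗ B.T

theorem t_fst_eq_zero_iff (hchar : (2 : K) ≠ 0) {u : Kˣ} (hu : cls u ∈ fixedJ F K) {k : K}
    (hk : k ^ 2 = u * B.σ₂ u) : (B.t hchar ⟨cls u, hu⟩).1 = 0 ↔ B.σ₂ k = k := by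
  have := B.finiteDimensional
  rw [← (B.isInvolutionOver_K₁ hchar).normJ_cls_eq_zero_iff hchar hk]
  exact (LinearEquiv.map_eq_zero_iff _).trans Subtype.ext_iff

theorem t_snd_fst_eq_zero_iff (hchar : (2 : K) ≠ 0) {u : Kˣ} (hu : cls u ∈ fixedJ F K) {k : K}
    (hk : k ^ 2 = u * B.σ₁ u) : (B.t hchar ⟨cls u, hu⟩).2.1 = 0 ↔ B.σ₁ k = k := by
  have := B.finiteDimensional
  rw [← (B.isInvolutionOver_K₂ hchar).normJ_cls_eq_zero_iff hchar hk]
  exact (LinearEquiv.map_eq_zero_iff _).trans Subtype.ext_iff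

theorem t_snd_snd_eq_zero_iff (hchar : (2 : K) ≠ 0) {u : Kˣ} (hu : cls u ∈ fixedJ F K) {k : K}
    (hk : k ^ 2 = u * (B.σ₁ * B.σ₂) u) :
    (B.t hchar ⟨cls u, hu⟩).2.2 = 0 ↔ (B.σ₁ * B.σ₂) k = k := by
  have := B.finiteDimensional
  rw [← (B.isInvolutionOver_K₃ hchar).normJ_cls_eq_zero_iff hchar hk]
  exact (LinearEquiv.map_eq_zero_iff _).trans Subtype.ext_iff

/-- If `D₁ D₂ x = 0`, so that the norm of `x` to `F` is a square `k²` in `K`, the values of `T` at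
`D₂ x` and `D₁ x` are both determined by the action of the Galois group on `k`. -/
theorem exists_t_D₂_D₁ (hchar : (2 : K) ≠ 0) {x : J K} (hx : B.D₁ (B.D₂ x) = 0) : ∃ c d : ZMod 2,
    B.t hchar ⟨B.D₂ x, B.D₂_mem_fixedJ hx⟩ = (0, c, c + d) ∧
      B.t hchar ⟨B.D₁ x, B.D₁_mem_fixedJ hx⟩ = (d, 0, c + d) := by
  obtain ⟨u, rfl⟩ := cls_surjective x
  have hx' := hx
  rw [D₂_cls, D₁_cls, cls_eq_zero_iff] at hx'
  obtain ⟨k, hk⟩ := hx'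
  have hk : (k : K) ^ 2 = (u * B.σ₂ u) * B.σ₁ (u * B.σ₂ u) :=
    congrArg (fun z : Kˣ => (z : K)) hk
  obtain ⟨c, d, hc, hd, hcd⟩ := B.exists_signs (k := k)
    (by rw [hk]; simp only [map_mul, σ₁_σ₁]; ring)
    (by rw [hk]; simp only [map_mul, σ₂_σ₂, σ₂_σ₁]; ring)
  have hfix₂ := B.D₂_mem_fixedJ hx
  have hfix₁ := B.D₁_mem_fixedJ hx
  simp only [D₂_cls, D₁_cls] at hfix₁ hfix₂ ⊢
  -- The norm of `u σ₂(u)` to `K₁` is its own square, with a root fixed by `σ₂`; its norms to `K₂`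
  -- and `K₃` both equal `k²`. For `u σ₁(u)` the roles of `K₁` and `K₂` are exchanged.
  refine ⟨c, d, Prod.ext ?_ (Prod.ext ?_ ?_), Prod.ext ?_ (Prod.ext ?_ ?_)⟩
  · refine (B.t_fst_eq_zero_iff hchar hfix₂ (k := u * B.σ₂ u) ?_).2 ?_
    · change _ = (u * B.σ₂ u) * B.σ₂ (u * B.σ₂ u)
      rw [map_mul, σ₂_σ₂]; ring
    · rw [map_mul, σ₂_σ₂]; ring
  · exact zmod_two_eq_of_iff ((B.t_snd_fst_eq_zero_iff hchar hfix₂ hk).trans hc)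
  · refine zmod_two_eq_of_iff ((B.t_snd_snd_eq_zero_iff hchar hfix₂ (k := k) ?_).trans hcd)
    rw [hk]
    change _ = (u * B.σ₂ u) * B.σ₁ (B.σ₂ (u * B.σ₂ u))
    simp only [map_mul, σ₂_σ₂]; ring
  · refine zmod_two_eq_of_iff ((B.t_fst_eq_zero_iff hchar hfix₁ (k := k) ?_).trans hd)
    rw [hk]
    change _ = (u * B.σ₁ u) * B.σ₂ (u * B.σ₁ u)
    simp only [map_mul, σ₂_σ₁]; ring
  · refine (B.t_snd_fst_eq_zero_iff hchar hfix₁ (k := u * B.σ₁ u) ?_).2 ?_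
    · change _ = (u * B.σ₁ u) * B.σ₁ (u * B.σ₁ u)
      rw [map_mul, σ₁_σ₁]; ring
    · rw [map_mul, σ₁_σ₁]; ring
  · refine zmod_two_eq_of_iff ((B.t_snd_snd_eq_zero_iff hchar hfix₁ (k := k) ?_).trans hcd)
    rw [hk]
    change _ = (u * B.σ₁ u) * B.σ₁ (B.σ₂ (u * B.σ₁ u))
    simp only [map_mul, σ₂_σ₁, σ₁_σ₁]; ring

/-- A class in `J(K)^G` with trivial first coordinate under `T` comes from `K₁`. -/
theorem exists_cls_eq_of_t_fst (hchar : (2 : K) ≠ 0) {x : fixedJ F K} (hx : (B.t hchar x).1 = 0) :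
    ∃ u : Kˣ, cls u = (x : J K) ∧ B.σ₂ (u : K) = u := by
  obtain ⟨x, hxf⟩ := x
  obtain ⟨u, rfl⟩ := cls_surjective x
  obtain ⟨k, hk⟩ := exists_sq_of_mem_fixedJ hxf B.σ₂
  obtain ⟨w, hw, h, -⟩ := exists_mul_sq_fixed B.r₂_ne_zero B.σ₂_r₂ u.ne_zero hk
    ((B.t_fst_eq_zero_iff hchar hxf hk).1 hx)
  exact ⟨u * Units.mk0 w hw ^ 2, (cls_eq_of_mul_sq rfl).symm, h⟩

theorem exists_cls_eq_of_t_snd_fst (hchar : (2 : K) ≠ 0) {x : fixedJ F K}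
    (hx : (B.t hchar x).2.1 = 0) :
    ∃ u : Kˣ, cls u = (x : J K) ∧ B.σ₁ (u : K) = u := by
  obtain ⟨x, hxf⟩ := x
  obtain ⟨u, rfl⟩ := cls_surjective x
  obtain ⟨k, hk⟩ := exists_sq_of_mem_fixedJ hxf B.σ₁
  obtain ⟨w, hw, h, -⟩ := exists_mul_sq_fixed B.r₁_ne_zero B.σ₁_r₁ u.ne_zero hk
    ((B.t_snd_fst_eq_zero_iff hchar hxf hk).1 hx)
  exact ⟨u * Units.mk0 w hw ^ 2, (cls_eq_of_mul_sq rfl).symm, h⟩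

/-- A trivial first coordinate gives a representative `u` in `K₁`. Then `σ₂ u = u`, so one root `k`
of `u σ₁(u)` computes both other coordinates, and their vanishing puts `k` in `F`. The Hilbert 90
correction for `σ₁`, built from `u`, `k` or `r₁`, is fixed by `σ₂`, so it carries `u` into `F`. -/
theorem t_eq_zero_iff (hchar : (2 : K) ≠ 0) (x : fixedJ F K) :
    B.t hchar x = 0 ↔ (x : J K) ∈ baseClasses F K := by
  constructor
  · intro hx
    obtain ⟨u, hu, hu₂⟩ := B.exists_cls_eq_of_t_fst hchar (congrArg Prod.fst hx)
    obtain ⟨x, hxf⟩ := x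
    change cls u = x at hu
    subst hu
    obtain ⟨k, hk⟩ := exists_sq_of_mem_fixedJ hxf B.σ₁
    have h₁ := (B.t_snd_fst_eq_zero_iff hchar hxf hk).1 (congrArg (fun p => p.2.1) hx)
    have h₃ := (B.t_snd_snd_eq_zero_iff hchar hxf (k := k)
      (by rw [AlgEquiv.mul_apply, hu₂, hk])).1 (congrArg (fun p => p.2.2) hx)
    have h₂ : B.σ₂ k = k := by
      rw [AlgEquiv.mul_apply, ← σ₂_σ₁, h₁] at h₃
      exact h₃
    obtain ⟨w, hw, h, h'⟩ := exists_mul_sq_fixed B.r₁_ne_zero B.σ₁_r₁ u.ne_zero hk h₁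
    have hw₂ := h' B.σ₂ hu₂ h₂ B.σ₂_r₁
    have he : cls u = cls (u * Units.mk0 w hw ^ 2) := cls_eq_of_mul_sq rfl
    change cls u ∈ _
    rw [he]
    refine B.mem_baseClasses_of_fixed h ?_
    change B.σ₂ ((u : K) * w ^ 2) = u * w ^ 2
    rw [map_mul, map_pow, hu₂, hw₂]
  · obtain ⟨x, hxf⟩ := x
    rintro ⟨y, hy⟩
    obtain ⟨f, rfl⟩ := cls_surjective y
    rw [incl, mapJ_cls] at hy
    change _ = x at hy
    subst hy
    have hg : ∀ g : Gal(K/F), g (algebraMap F K f) = algebraMap F K f := fun g => g.commutes _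
    refine Prod.ext ?_ (Prod.ext ?_ ?_)
    · exact (B.t_fst_eq_zero_iff hchar hxf ((sq _).trans (congrArg _ (hg _).symm))).2 (hg _)
    · exact (B.t_snd_fst_eq_zero_iff hchar hxf ((sq _).trans (congrArg _ (hg _).symm))).2 (hg _)
    · exact (B.t_snd_snd_eq_zero_iff hchar hxf ((sq _).trans (congrArg _ (hg _).symm))).2 (hg _)

/-- Every pair of values of `T` allowed by `exists_t_D₂_D₁` and lying in the image of `T` is
attained. -/
theorem exists_of_mem_range_t (hchar : (2 : K) ≠ 0) {c d : ZMod 2}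
    (h₂ : (0, c, c + d) ∈ LinearMap.range (B.t hchar))
    (h₁ : (d, 0, c + d) ∈ LinearMap.range (B.t hchar)) :
    ∃ (x : J K) (hx : B.D₁ (B.D₂ x) = 0),
      B.t hchar ⟨B.D₂ x, B.D₂_mem_fixedJ hx⟩ = (0, c, c + d) ∧
      B.t hchar ⟨B.D₁ x, B.D₁_mem_fixedJ hx⟩ = (d, 0, c + d) := by
  obtain ⟨a, ha⟩ := h₂
  obtain ⟨b, hb⟩ := h₁
  obtain ⟨u, hu, hu₂⟩ := B.exists_cls_eq_of_t_fst hchar (x := a) (by rw [ha])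
  obtain ⟨v, hv, hv₁⟩ := B.exists_cls_eq_of_t_snd_fst hchar (x := b) (by rw [hb])
  obtain ⟨a, haf⟩ := a
  obtain ⟨b, hbf⟩ := b
  change cls u = a at hu
  change cls v = b at hv
  subst hu hv
  obtain ⟨k, hk⟩ := exists_sq_of_mem_fixedJ haf B.σ₁
  obtain ⟨l, hl⟩ := exists_sq_of_mem_fixedJ hbf B.σ₂
  have hk0 : k ≠ 0 := by
    rintro rfl
    rw [zero_pow two_ne_zero] at hk
    exact mul_ne_zero u.ne_zero (by simp) hk.symm
  have hl0 : l ≠ 0 := by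
    rintro rfl
    rw [zero_pow two_ne_zero] at hl
    exact mul_ne_zero v.ne_zero (by simp) hl.symm
  obtain ⟨c₁, d₁, hc₁, hd₁, hcd₁⟩ := B.exists_signs (k := k)
    (by rw [hk]; simp only [map_mul, σ₁_σ₁]; ring)
    (by rw [hk]; simp only [map_mul, σ₂_σ₁, hu₂])
  obtain ⟨c₂, d₂, hc₂, hd₂, hcd₂⟩ := B.exists_signs (k := l)
    (by rw [hl]; simp only [map_mul, ← σ₂_σ₁, hv₁])
    (by rw [hl]; simp only [map_mul, σ₂_σ₂]; ring)
  -- The signs of `k` and `l` are read off from the coordinates of `T` at `a` and `b`, so they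
  -- coincide with `(c, d)` in both cases.
  have ec : c = c₁ := zmod_two_eq_of_iff
    (((B.t_snd_fst_eq_zero_iff hchar haf hk).symm.trans (by rw [ha])).symm.trans hc₁)
  have ecd : c + d = c₁ + d₁ := zmod_two_eq_of_iff
    (((B.t_snd_snd_eq_zero_iff hchar haf (k := k)
      (by rw [AlgEquiv.mul_apply, hu₂, hk])).symm.trans (by rw [ha])).symm.trans hcd₁)
  have ed' : d = d₂ := zmod_two_eq_of_iff
    (((B.t_fst_eq_zero_iff hchar hbf hl).symm.trans (by rw [hb])).symm.trans hd₂)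
  have ecd' : c + d = c₂ + d₂ := zmod_two_eq_of_iff
    (((B.t_snd_snd_eq_zero_iff hchar hbf (k := l)
      (by rw [AlgEquiv.mul_apply, ← σ₂_σ₁, hv₁, hl])).symm.trans (by rw [hb])).symm.trans hcd₂)
  -- Equal signs cancel in the quotient; hence `k / l` lies in `F`.
  have hfix : ∀ g : Gal(K/F), (g k = k ↔ g l = l) → g (k ^ 2) = k ^ 2 → g (l ^ 2) = l ^ 2 →
      g (k / l) = k / l := by
    intro g h hk2 hl2
    rw [map_pow, sq_eq_sq_iff_eq_or_eq_neg] at hk2 hl2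
    rw [map_div₀]
    rcases hk2 with h1 | h1
    · rw [h1, h.1 h1]
    · rcases hl2 with h2 | h2
      · rw [h2, h.2 h2]
      · rw [h1, h2, neg_div_neg_eq]
  have ec' : c₁ = c₂ := by
    rw [← ec, ← add_left_inj d, ecd', ed']
  have ed : d₁ = d₂ := by
    rw [← ed', ← add_right_inj c, ecd, ec]
  have f₁ : B.σ₁ (k / l) = k / l := hfix _ (by rw [hc₁, hc₂, ec'])
    (by rw [hk]; simp only [map_mul, σ₁_σ₁]; ring)
    (by rw [hl]; simp only [map_mul, ← σ₂_σ₁, hv₁])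
  have f₂ : B.σ₂ (k / l) = k / l := hfix _ (by rw [hd₁, hd₂, ed])
    (by rw [hk]; simp only [map_mul, σ₂_σ₁, hu₂])
    (by rw [hl]; simp only [map_mul, σ₂_σ₂]; ring)
  have hkl : k / l ≠ 0 := div_ne_zero hk0 hl0
  -- Multiplying `v` by `k / l` makes its norm to `F` equal to that of `u`. This factor and `f` come
  -- from `F`, so they do not affect `T`.
  obtain ⟨x, f, hx, hf, hf₁, hf₂, hx₂, hx₁⟩ := B.exists_common_norm (c := u) (d := v * (k / l))
    u.ne_zero hu₂ (by rw [map_mul, hv₁, f₁]) (by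
      rw [map_mul, f₂, ← hk, mul_mul_mul_comm, ← hl]
      field_simp)
  have e₂ : B.D₂ (cls (Units.mk0 x hx)) = cls u + cls (Units.mk0 f hf) := by
    rw [D₂_cls, ← cls_mul]
    congr 1
    ext
    exact hx₂
  have e₁ : B.D₁ (cls (Units.mk0 x hx)) =
      cls v + cls (Units.mk0 (k / l) hkl * Units.mk0 f hf) := by
    rw [D₁_cls, ← cls_mul]
    congr 1
    ext
    exact hx₁.trans (mul_assoc _ _ _)
  have b₂ : cls (Units.mk0 f hf) ∈ baseClasses F K := B.mem_baseClasses_of_fixed hf₁ hf₂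
  have b₁ : cls (Units.mk0 (k / l) hkl * Units.mk0 f hf) ∈ baseClasses F K :=
    B.mem_baseClasses_of_fixed (by
      change B.σ₁ (k / l * f) = k / l * f
      rw [map_mul, f₁, hf₁]) (by
      change B.σ₂ (k / l * f) = k / l * f
      rw [map_mul, f₂, hf₂])
  have g₂ := baseClasses_le_fixedJ b₂
  have g₁ := baseClasses_le_fixedJ b₁
  have h0 : B.D₁ (B.D₂ (cls (Units.mk0 x hx))) = 0 := by
    rw [e₂]
    exact (B.mem_fixedJ_iff.1 (add_mem haf g₂)).1
  refine ⟨cls (Units.mk0 x hx), h0, ?_, ?_⟩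
  · have : (⟨_, B.D₂_mem_fixedJ h0⟩ : fixedJ F K) = ⟨_, haf⟩ + ⟨_, g₂⟩ := Subtype.ext e₂
    rw [this, map_add, ha, (B.t_eq_zero_iff hchar ⟨_, g₂⟩).2 b₂, add_zero]
  · have : (⟨_, B.D₁_mem_fixedJ h0⟩ : fixedJ F K) = ⟨_, hbf⟩ + ⟨_, g₁⟩ := Subtype.ext e₁
    rw [this, map_add, hb, (B.t_eq_zero_iff hchar ⟨_, g₁⟩).2 b₁, add_zero]

/-- `σ₂` is the involution with fixed field `K₁`, so the norm to `K₁` acts on classes as `1 + σ₂`.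
Together with the analogue for `K₂`, this makes `S` the intersection of the ranges of `D₂` and `D₁`.
-/
theorem normClasses_K₁ (hchar : (2 : K) ≠ 0) : normClasses B.K₁ = LinearMap.range B.D₂ := by
  have := B.finiteDimensional
  rw [normClasses]
  congr 1
  ext x
  exact (B.isInvolutionOver_K₁ hchar).incl_normJ hchar x

theorem normClasses_K₂ (hchar : (2 : K) ≠ 0) : normClasses B.K₂ = LinearMap.range B.D₁ := by
  have := B.finiteDimensional
  rw [normClasses]
  congr 1
  ext x
  exact (B.isInvolutionOver_K₂ hchar).incl_normJ hchar x

end Presentation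

end Biquadratic

namespace Biquadratic

namespace Presentation

variable {F K : Type*} [Field F] [Field K] [Algebra F K] [IsGalois F K] (B : Presentation F K)

/-! ### Construction of `X` from the image of `T` -/

theorem t_eq_iff (hchar : (2 : K) ≠ 0) {x y : fixedJ F K} :
    B.t hchar x = B.t hchar y ↔ B.T x = B.T y :=
  (B.targetEquiv hchar).injective.eq_iff

theorem map_range_T (hchar : (2 : K) ≠ 0) :
    (LinearMap.range B.T).map (B.targetEquiv hchar : _ →ₗ[ZMod 2] _) =
      LinearMap.range (B.t hchar) :=
  (LinearMap.range_comp _ _).symm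

theorem finrank_range_t (hchar : (2 : K) ≠ 0) :
    Module.finrank (ZMod 2) (LinearMap.range (B.t hchar)) =
      Module.finrank (ZMod 2) (LinearMap.range B.T) := by
  rw [← map_range_T]
  exact LinearEquiv.finrank_map_eq (B.targetEquiv hchar) _

theorem imT_eq_range (hchar : (2 : K) ≠ 0) {S : Submodule (ZMod 2) (J K)}
    (h : ∀ p ∈ LinearMap.range (B.t hchar), ∃ x : fixedJ F K, (x : J K) ∈ S ∧ B.t hchar x = p) :
    B.imT S = LinearMap.range B.T := by
  refine le_antisymm LinearMap.map_le_range ?_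
  rintro _ ⟨y, rfl⟩
  obtain ⟨x, hx, hxy⟩ := h _ ⟨y, rfl⟩
  exact ⟨x, hx, (B.t_eq_iff hchar).1 hxy⟩

theorem imT_eq_bot_iff (hchar : (2 : K) ≠ 0) {S : Submodule (ZMod 2) (J K)} :
    B.imT S = ⊥ ↔ ∀ x : fixedJ F K, (x : J K) ∈ S → B.t hchar x = 0 := by
  have h : ∀ x : fixedJ F K, B.t hchar x = 0 ↔ B.T x = 0 := fun x => by
    rw [← map_zero (B.t hchar), t_eq_iff, map_zero]
  simp only [h]
  refine ⟨fun h x hx => (Submodule.eq_bot_iff _).1 h _ ⟨x, hx, rfl⟩, fun h => ?_⟩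
  rw [eq_bot_iff]
  rintro _ ⟨x, hx, rfl⟩
  exact h x hx

section Embedding

variable {M : Type*} [AddCommGroup M] [Module (ZMod 2) M]
  {ρ : Representation (ZMod 2) Gal(K/F) M}

/-- An equivariant map to `J(K)` from a module of Loewy length at most two, whose composition with
`T` is on the fixed part a bijection to the image of `T`, yields a submodule as required. -/
theorem isIso_range (hchar : (2 : K) ≠ 0) (Φ : Representation.IntertwiningMap ρ (galJ F K))
    (hρ : ∀ g v, ρ g v - v ∈ ρ.invariants)
    (hinj : ∀ v (hv : v ∈ ρ.invariants),
      B.t hchar ⟨Φ v, mem_invariants_of_map Φ hv⟩ = 0 → v = 0)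
    (hsurj : ∀ p ∈ LinearMap.range (B.t hchar), ∃ (v : M) (hv : v ∈ ρ.invariants),
      B.t hchar ⟨Φ v, mem_invariants_of_map Φ hv⟩ = p) :
    IsIso Φ.range ρ ∧ B.imT (fixedPart Φ.range) = LinearMap.range B.T ∧
      baseClasses F K ⊓ fixedPart Φ.range = ⊥ := by
  have hΦ : Function.Injective Φ := injective_of_injOn_invariants Φ hρ fun v hv h0 => by
    refine hinj v hv ?_
    rw [t_eq_zero_iff, Subtype.coe_mk, h0]
    exact zero_mem _
  refine ⟨nonempty_equiv_range Φ hΦ, B.imT_eq_range hchar fun p hp => ?_, ?_⟩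
  · obtain ⟨v, hv, h⟩ := hsurj p hp
    exact ⟨_, ⟨⟨v, rfl⟩, mem_invariants_of_map Φ hv⟩, h⟩
  · rw [fixedPart, range_inf_invariants Φ hΦ, eq_bot_iff]
    rintro _ ⟨hb, v, hv, rfl⟩
    have : v = 0 := hinj v hv ((B.t_eq_zero_iff hchar _).2 hb)
    rw [this, map_zero]
    exact zero_mem _

/-- Every subspace of `J(K)^G` is a submodule, so any linear section of `T` over its image will do.
-/
theorem exists_isIso_of_trivial (hchar : (2 : K) ≠ 0) (hρ : ∀ g v, ρ g v = v)
    (e : M ≃ₗ[ZMod 2] LinearMap.range (B.t hchar)) :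
    ∃ X : Subrepresentation (galJ F K), IsIso X ρ ∧
      B.imT (fixedPart X) = LinearMap.range B.T ∧ baseClasses F K ⊓ fixedPart X = ⊥ := by
  obtain ⟨s, hs⟩ := (B.t hchar).rangeRestrict.exists_rightInverse_of_surjective
    (LinearMap.range_rangeRestrict _)
  have hs' : ∀ p, B.t hchar (s p) = p := fun p => congrArg Subtype.val (LinearMap.congr_fun hs p)
  refine ⟨_, B.isIso_range hchar (ρ := ρ)
    ⟨(fixedJ F K).subtype ∘ₗ s ∘ₗ (e : M →ₗ[ZMod 2] _), fun g => ?_⟩ ?_ ?_ ?_⟩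
  · ext v
    change ((s (e (ρ g v)) : fixedJ F K) : J K) = galJ F K g (s (e v) : fixedJ F K)
    rw [hρ, (s (e v)).2 g]
  · intro g v
    rw [hρ, sub_self]
    exact zero_mem _
  · intro v hv h
    have h : B.t hchar (s (e v)) = 0 := h
    rw [hs'] at h
    exact (LinearEquiv.map_eq_zero_iff e).1 (Subtype.ext h)
  · intro p hp
    refine ⟨e.symm ⟨p, hp⟩, fun g => hρ g _, ?_⟩
    change B.t hchar (s (e (e.symm ⟨p, hp⟩))) = p
    rw [hs', LinearEquiv.apply_symm_apply]

end Embedding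

theorem t_omegaMap (hchar : (2 : K) ≠ 0) {n : ℕ} (α : Fin n → J K) (β : Fin (n + 1) → J K)
    (hβ : ∀ i, β i ∈ fixedJ F K) (h₁ : ∀ i, B.D₁ (α i) = β i.succ)
    (h₂ : ∀ i, B.D₂ (α i) = β i.castSucc) (v) (hv : v ∈ (B.omegaNeg n).invariants) (hΦ) :
    B.t hchar ⟨B.omegaMap α β hβ h₁ h₂ v, hΦ⟩ = ∑ i, v.2 i • B.t hchar ⟨β i, hβ i⟩ := by
  simp only [← map_smul, ← map_sum]
  congr 1
  ext
  simp [B.omegaMap_apply α β hβ h₁ h₂ v (B.mem_invariants_omegaNeg_iff.1 hv)]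

/-- For `(c, d) ≠ 0` the two triples are independent, so the `Ω⁻¹` generated by one suitable `x` has
fixed part mapped isomorphically onto their span. -/
theorem exists_isIso_omegaNeg_one (hchar : (2 : K) ≠ 0) {c d : ZMod 2} (hcd : c ≠ 0 ∨ d ≠ 0)
    (h : ∀ p, p ∈ LinearMap.range (B.t hchar) ↔
      ∃ a b : ZMod 2, p = a • (0, c, c + d) + b • (d, 0, c + d)) :
    ∃ X : Subrepresentation (galJ F K), IsIso X (B.omegaNeg 1) ∧
      B.imT (fixedPart X) = LinearMap.range B.T ∧ baseClasses F K ⊓ fixedPart X = ⊥ := by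
  obtain ⟨x, hx, h₂, h₁⟩ := B.exists_of_mem_range_t hchar (c := c) (d := d)
    ((h _).2 ⟨1, 0, by simp⟩) ((h _).2 ⟨0, 1, by simp⟩)
  have key : ∀ v (hv : v ∈ (B.omegaNeg 1).invariants) (hΦ),
      B.t hchar ⟨B.omegaMapOne hx v, hΦ⟩ =
        v.2 0 • (0, c, c + d) + v.2 1 • (d, 0, c + d) := by
    intro v hv hΦ
    refine (B.t_omegaMap hchar _ _ _ _ _ v hv hΦ).trans ?_
    rw [Fin.sum_univ_two, ← h₁, ← h₂]
    rfl
  refine ⟨_, B.isIso_range hchar (B.omegaMapOne hx)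
    (fun g v => B.omegaNeg_sub_mem_invariants g v) ?_ ?_⟩
  · intro v hv h0
    rw [key v hv] at h0
    have aux : ∀ a b c d : ZMod 2, c ≠ 0 ∨ d ≠ 0 →
      a • ((0, c, c + d) : ZMod 2 × ZMod 2 × ZMod 2) + b • (d, 0, c + d) = 0 →
      a = 0 ∧ b = 0 := by decide
    refine Prod.ext (B.mem_invariants_omegaNeg_iff.1 hv) (funext ?_)
    exact Fin.forall_fin_two.2 (aux _ _ _ _ hcd h0)
  · intro p hp
    obtain ⟨a, b, rfl⟩ := (h p).1 hp
    exact ⟨(0, ![a, b]), B.mem_invariants_omegaNeg_iff.2 rfl,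
      key _ (B.mem_invariants_omegaNeg_iff.2 rfl) _⟩

theorem exists_isIso_of_isCoordinatePlane (hchar : (2 : K) ≠ 0)
    (h : B.IsCoordinatePlane (LinearMap.range B.T)) :
    ∃ X : Subrepresentation (galJ F K), IsIso X (B.omegaNeg 1) ∧
      B.imT (fixedPart X) = LinearMap.range B.T ∧ baseClasses F K ⊓ fixedPart X = ⊥ := by
  have hmem : ∀ p, p ∈ LinearMap.range (B.t hchar) ↔
      (B.targetEquiv hchar).symm p ∈ LinearMap.range B.T := fun p => by
    rw [← map_range_T]
    exact Submodule.mem_map_equiv (e := B.targetEquiv hchar) _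
  rcases h with h | h | h
  · refine B.exists_isIso_omegaNeg_one hchar (c := 1) (d := 0) (by decide) fun p => ?_
    rw [hmem, h]
    refine (LinearEquiv.map_eq_zero_iff
      ((B.isInvolutionOver_K₁ hchar).relSqEquiv hchar).symm (x := p.1)).trans ?_
    revert p
    decide
  · refine B.exists_isIso_omegaNeg_one hchar (c := 0) (d := 1) (by decide) fun p => ?_
    rw [hmem, h]
    refine (LinearEquiv.map_eq_zero_iff
      ((B.isInvolutionOver_K₂ hchar).relSqEquiv hchar).symm (x := p.2.1)).trans ?_
    revert p
    decide
  · refine B.exists_isIso_omegaNeg_one hchar (c := 1) (d := 1) (by decide) fun p => ?_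
    rw [hmem, h]
    refine (LinearEquiv.map_eq_zero_iff
      ((B.isInvolutionOver_K₃ hchar).relSqEquiv hchar).symm (x := p.2.2)).trans ?_
    revert p
    decide

/-- A class `s = D₂ x₂ = D₁ x₁` with `T(s) ≠ 0` serves as the middle basis vector `β₂`, shared by
the modules generated by `x₁` and `x₂`. -/
theorem exists_isIso_omegaNeg_two (hchar : (2 : K) ≠ 0)
    (hS : B.imT (normClasses B.K₁ ⊓ normClasses B.K₂) ≠ ⊥) :
    ∃ X : Subrepresentation (galJ F K), IsIso X (B.omegaNeg 2) ∧
      B.imT (fixedPart X) = LinearMap.range B.T ∧ baseClasses F K ⊓ fixedPart X = ⊥ := by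
  rw [Ne, B.imT_eq_bot_iff hchar, B.normClasses_K₁ hchar, B.normClasses_K₂ hchar] at hS
  push Not at hS
  obtain ⟨⟨s, hs⟩, ⟨⟨x₂, h₂⟩, x₁, h₁⟩, hts⟩ := hS
  change B.D₂ x₂ = s at h₂
  change B.D₁ x₁ = s at h₁
  have hx₂ : B.D₁ (B.D₂ x₂) = 0 := by rw [h₂, ← h₁, D₁_D₁]
  have hx₁ : B.D₁ (B.D₂ x₁) = 0 := by rw [← D₂_D₁, h₁, ← h₂, D₂_D₂]
  obtain ⟨c₁, d₁, e₁₂, e₁₁⟩ := B.exists_t_D₂_D₁ hchar hx₁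
  obtain ⟨c₂, d₂, e₂₂, e₂₁⟩ := B.exists_t_D₂_D₁ hchar hx₂
  simp only [h₁] at e₁₁
  simp only [h₂] at e₂₂
  have heq := e₁₁.symm.trans e₂₂
  rw [e₁₁] at hts
  -- The two shapes of `T(s)` are compatible only at `(0, 0, 1)`, which determines all four signs.
  have aux : ∀ c₁ d₁ c₂ d₂ : ZMod 2,
      ((d₁, 0, c₁ + d₁) : ZMod 2 × ZMod 2 × ZMod 2) = (0, c₂, c₂ + d₂) →
      ((d₁, 0, c₁ + d₁) : ZMod 2 × ZMod 2 × ZMod 2) = 0 ∨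
        c₁ = 1 ∧ d₁ = 0 ∧ c₂ = 0 ∧ d₂ = 1 := by decide
  obtain ⟨rfl, rfl, rfl, rfl⟩ := (aux _ _ _ _ heq).resolve_left hts
  let β : Fin 3 → J K := ![B.D₂ x₁, s, B.D₁ x₂]
  have hβ : ∀ i, β i ∈ fixedJ F K := by
    intro i
    fin_cases i
    · exact B.D₂_mem_fixedJ hx₁
    · exact hs
    · exact B.D₁_mem_fixedJ hx₂
  let Φ := B.omegaMap ![x₁, x₂] β hβ (Fin.forall_fin_two.2 ⟨h₁, rfl⟩)
    (Fin.forall_fin_two.2 ⟨rfl, h₂⟩)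
  have key : ∀ v (hv : v ∈ (B.omegaNeg 2).invariants) (hΦ),
      B.t hchar ⟨Φ v, hΦ⟩ =
        v.2 0 • (0, 1, 1) + v.2 1 • (0, 0, 1) + v.2 2 • (1, 0, 1) := by
    intro v hv hΦ
    refine (B.t_omegaMap hchar _ _ _ _ _ v hv hΦ).trans ?_
    rw [Fin.sum_univ_three]
    exact congrArg₂ _ (congrArg₂ _ (congrArg _ e₁₂) (congrArg _ e₁₁)) (congrArg _ e₂₁)
  refine ⟨_, B.isIso_range hchar Φ (fun g v => B.omegaNeg_sub_mem_invariants g v) ?_ ?_⟩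
  · intro v hv h0
    rw [key v hv] at h0
    have aux : ∀ a b c : ZMod 2,
      a • ((0, 1, 1) : ZMod 2 × ZMod 2 × ZMod 2) + b • (0, 0, 1) + c • (1, 0, 1) = 0 →
      a = 0 ∧ b = 0 ∧ c = 0 := by decide
    obtain ⟨ha, hb, hc⟩ := aux _ _ _ h0
    refine Prod.ext (B.mem_invariants_omegaNeg_iff.1 hv) (funext fun i => ?_)
    fin_cases i
    · exact ha
    · exact hb
    · exact hc
  · intro p _
    have aux : ∀ p : ZMod 2 × ZMod 2 × ZMod 2, ∃ a b c : ZMod 2,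
      a • ((0, 1, 1) : ZMod 2 × ZMod 2 × ZMod 2) + b • (0, 0, 1) + c • (1, 0, 1) = p := by decide
    obtain ⟨a, b, c, rfl⟩ := aux p
    exact ⟨(0, ![a, b, c]), B.mem_invariants_omegaNeg_iff.2 rfl,
      key _ (B.mem_invariants_omegaNeg_iff.2 rfl) _⟩

/-- The fixed part of the sum has dimension 4 and maps onto a space of dimension 3. The one relation
is `T(D₁ x₁) = T(D₂ x₂)`; triviality of `T(S)` prevents it from lifting to `D₁ x₁ = D₂ x₂`, so the
sum is direct. -/
theorem exists_isIso_omegaNeg_one_prod (hchar : (2 : K) ≠ 0)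
    (hT : LinearMap.range (B.t hchar) = ⊤)
    (hS : B.imT (normClasses B.K₁ ⊓ normClasses B.K₂) = ⊥) :
    ∃ X : Subrepresentation (galJ F K), IsIso X ((B.omegaNeg 1).prod (B.omegaNeg 1)) ∧
      B.imT (fixedPart X) = LinearMap.range B.T ∧
      Module.finrank (ZMod 2) (fixedPart X ⊓ baseClasses F K : Submodule (ZMod 2) (J K)) = 1 ∧
      fixedPart X ⊓ (B.𝔅 ⊔ B.ℭ ⊔ B.𝔇) = ⊥ := by
  rw [B.imT_eq_bot_iff hchar, B.normClasses_K₁ hchar, B.normClasses_K₂ hchar] at hS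
  obtain ⟨x₁, hx₁, e₁₂, e₁₁⟩ := B.exists_of_mem_range_t hchar (c := 1) (d := 0)
    (hT ▸ Submodule.mem_top) (hT ▸ Submodule.mem_top)
  obtain ⟨x₂, hx₂, e₂₂, e₂₁⟩ := B.exists_of_mem_range_t hchar (c := 0) (d := 1)
    (hT ▸ Submodule.mem_top) (hT ▸ Submodule.mem_top)
  let Φ : Representation.IntertwiningMap ((B.omegaNeg 1).prod (B.omegaNeg 1)) (galJ F K) :=
    B.intertwiningMap ((B.omegaMapOne hx₁).toLinearMap.coprod (B.omegaMapOne hx₂).toLinearMap)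
      (fun v => by
        simp only [LinearMap.coprod_apply, map_add]
        exact congrArg₂ (· + ·) (intertwiningMap_apply (B.omegaMapOne hx₁) B.σ₁ v.1)
          (intertwiningMap_apply (B.omegaMapOne hx₂) B.σ₁ v.2))
      (fun v => by
        simp only [LinearMap.coprod_apply, map_add]
        exact congrArg₂ (· + ·) (intertwiningMap_apply (B.omegaMapOne hx₁) B.σ₂ v.1)
          (intertwiningMap_apply (B.omegaMapOne hx₂) B.σ₂ v.2))
  have hinv : ∀ v, v ∈ ((B.omegaNeg 1).prod (B.omegaNeg 1)).invariants ↔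
      v.1 ∈ (B.omegaNeg 1).invariants ∧ v.2 ∈ (B.omegaNeg 1).invariants := fun v =>
    ⟨fun h => ⟨fun g => congrArg Prod.fst (h g), fun g => congrArg Prod.snd (h g)⟩,
      fun h g => Prod.ext (h.1 g) (h.2 g)⟩
  have happ : ∀ v ∈ ((B.omegaNeg 1).prod (B.omegaNeg 1)).invariants, Φ v =
      (v.1.2 0 • B.D₂ x₁ + v.1.2 1 • B.D₁ x₁) + (v.2.2 0 • B.D₂ x₂ + v.2.2 1 • B.D₁ x₂) :=
    fun v hv => congrArg₂ (· + ·) (B.omegaMapOne_apply hx₁ ((hinv v).1 hv).1)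
      (B.omegaMapOne_apply hx₂ ((hinv v).1 hv).2)
  have key : ∀ v (hv : v ∈ ((B.omegaNeg 1).prod (B.omegaNeg 1)).invariants) (hΦ),
      B.t hchar ⟨Φ v, hΦ⟩ = (v.1.2 0 • (0, 1, 1) + v.1.2 1 • (0, 0, 1)) +
        (v.2.2 0 • (0, 0, 1) + v.2.2 1 • (1, 0, 1)) := by
    intro v hv hΦ
    have h : (⟨Φ v, hΦ⟩ : fixedJ F K) =
        (v.1.2 0 • ⟨_, B.D₂_mem_fixedJ hx₁⟩ + v.1.2 1 • ⟨_, B.D₁_mem_fixedJ hx₁⟩) +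
        (v.2.2 0 • ⟨_, B.D₂_mem_fixedJ hx₂⟩ + v.2.2 1 • ⟨_, B.D₁_mem_fixedJ hx₂⟩) :=
      Subtype.ext (happ v hv)
    rw [h]
    simp only [map_add, map_smul, e₁₁, e₁₂, e₂₁, e₂₂]
    rfl
  -- the class `z` spans the intersection of the fixed part with `[Fˣ]`
  set z : J K := B.D₁ x₁ + B.D₂ x₂ with hz
  -- A common value would lie in `S`, where `T` vanishes, although `T(D₁ y₁) = T(D₁ x₁) = (0, 0,
  -- 1)`. Allowing `D₁ y₁` to vary modulo `[Fˣ]` serves both `z ≠ 0` and the statement on `𝔅 + ℭ +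
  -- 𝔇`.
  have hnot : ∀ y₁ y₂ : J K, (hy : B.D₁ y₁ - B.D₁ x₁ ∈ baseClasses F K) →
      B.D₁ y₁ ≠ B.D₂ y₂ := by
    intro y₁ y₂ hy h
    have hfix : B.D₁ y₁ ∈ fixedJ F K :=
      B.mem_fixedJ_iff.2 ⟨B.D₁_D₁ _, by rw [h, D₂_D₂]⟩
    have h0 := hS ⟨_, hfix⟩ ⟨⟨y₂, h.symm⟩, ⟨y₁, rfl⟩⟩
    have h1 := (B.t_eq_zero_iff hchar (⟨_, hfix⟩ - ⟨_, B.D₁_mem_fixedJ hx₁⟩)).2 hy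
    rw [map_sub, h0, e₁₁] at h1
    revert h1
    decide
  have hz0 : z ≠ 0 := by
    intro h
    refine hnot x₁ x₂ (by rw [sub_self]; exact zero_mem _) ?_
    rw [← add_left_inj (B.D₂ x₂), add_self]
    exact h
  have hrel : ∀ v ∈ ((B.omegaNeg 1).prod (B.omegaNeg 1)).invariants,
      Φ v ∈ baseClasses F K → v.1.2 0 = 0 ∧ v.1.2 1 = v.2.2 0 ∧ v.2.2 1 = 0 := by
    intro v hv hb
    have h0 := (B.t_eq_zero_iff hchar ⟨Φ v, mem_invariants_of_map Φ hv⟩).2 hb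
    rw [key v hv] at h0
    have aux : ∀ a b c d : ZMod 2,
      (a • ((0, 1, 1) : ZMod 2 × ZMod 2 × ZMod 2) + b • (0, 0, 1)) +
        (c • (0, 0, 1) + d • (1, 0, 1)) = 0 → a = 0 ∧ b = c ∧ d = 0 := by decide
    exact aux _ _ _ _ h0
  have hΦz : ∀ v ∈ ((B.omegaNeg 1).prod (B.omegaNeg 1)).invariants,
      Φ v ∈ baseClasses F K → Φ v = v.1.2 1 • z := by
    intro v hv hb
    obtain ⟨h1, h2, h3⟩ := hrel v hv hb
    rw [happ v hv, h1, h3, ← h2, zero_smul, zero_smul, zero_add, add_zero, ← smul_add]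
  have hΦ : Function.Injective Φ := by
    refine injective_of_injOn_invariants Φ (fun g v => ?_) fun v hv h0 => ?_
    · exact (hinv _).2 ⟨B.omegaNeg_sub_mem_invariants g v.1, B.omegaNeg_sub_mem_invariants g v.2⟩
    · have hb : Φ v ∈ baseClasses F K := by
        rw [h0]
        exact zero_mem _
      obtain ⟨h1, h2, h3⟩ := hrel v hv hb
      have h4 : v.1.2 1 = 0 := by
        have h := hΦz v hv hb
        rw [h0, eq_comm, smul_eq_zero] at h
        exact h.resolve_right hz0
      refine Prod.ext (Prod.ext (B.mem_invariants_omegaNeg_iff.1 ((hinv v).1 hv).1) (funext ?_))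
        (Prod.ext (B.mem_invariants_omegaNeg_iff.1 ((hinv v).1 hv).2) (funext ?_))
      · exact Fin.forall_fin_two.2 ⟨h1, h4⟩
      · exact Fin.forall_fin_two.2 ⟨h2.symm.trans h4, h3⟩
  have hmem : ∀ a b c d : ZMod 2, (((0, ![a, b]), (0, ![c, d])) :
      ((Fin 1 → ZMod 2) × (Fin 2 → ZMod 2)) × ((Fin 1 → ZMod 2) × (Fin 2 → ZMod 2))) ∈
      ((B.omegaNeg 1).prod (B.omegaNeg 1)).invariants := fun a b c d =>
    (hinv _).2 ⟨B.mem_invariants_omegaNeg_iff.2 rfl, B.mem_invariants_omegaNeg_iff.2 rfl⟩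
  have hzb : z ∈ baseClasses F K := by
    have hzf : z ∈ fixedJ F K := add_mem (B.D₁_mem_fixedJ hx₁) (B.D₂_mem_fixedJ hx₂)
    refine (B.t_eq_zero_iff hchar ⟨z, hzf⟩).1 ?_
    have h : (⟨z, hzf⟩ : fixedJ F K) =
      ⟨_, B.D₁_mem_fixedJ hx₁⟩ + ⟨_, B.D₂_mem_fixedJ hx₂⟩ := rfl
    rw [h, map_add, e₁₁, e₂₂]
    decide
  have hspan : fixedPart Φ.range ⊓ baseClasses F K = Submodule.span (ZMod 2) {z} := by
    rw [fixedPart, range_inf_invariants Φ hΦ]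
    apply le_antisymm
    · rintro _ ⟨⟨v, hv, rfl⟩, hb⟩
      exact Submodule.mem_span_singleton.2 ⟨_, (hΦz v hv hb).symm⟩
    · rw [Submodule.span_singleton_le_iff_mem]
      refine ⟨⟨_, hmem 0 1 1 0, ?_⟩, hzb⟩
      refine (happ _ (hmem 0 1 1 0)).trans ?_
      simp [hz]
  refine ⟨Φ.range, nonempty_equiv_range Φ hΦ, B.imT_eq_range hchar fun p _ => ?_, ?_, ?_⟩
  · have aux : ∀ p : ZMod 2 × ZMod 2 × ZMod 2, ∃ a b c d : ZMod 2,
      (a • ((0, 1, 1) : ZMod 2 × ZMod 2 × ZMod 2) + b • (0, 0, 1)) +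
        (c • (0, 0, 1) + d • (1, 0, 1)) = p := by decide
    obtain ⟨a, b, c, d, rfl⟩ := aux p
    exact ⟨⟨_, mem_invariants_of_map Φ (hmem a b c d)⟩,
      ⟨⟨_, rfl⟩, mem_invariants_of_map Φ (hmem a b c d)⟩, key _ (hmem a b c d) _⟩
  · rw [hspan]
    exact finrank_span_singleton hz0
  · rw [eq_bot_iff]
    rintro y ⟨hy, hy'⟩
    have hle : B.𝔅 ⊔ B.ℭ ⊔ B.𝔇 ≤ baseClasses F K :=
      sup_le (sup_le inf_le_left inf_le_left) inf_le_left
    have hyb : y ∈ baseClasses F K := hle hy'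
    have hyz : y ∈ Submodule.span (ZMod 2) {z} := hspan ▸ ⟨hy, hyb⟩
    obtain ⟨a, rfl⟩ := Submodule.mem_span_singleton.1 hyz
    by_cases ha : a = 0
    · rw [ha, zero_smul]
      exact zero_mem _
    have aux : ∀ a : ZMod 2, a ≠ 0 → a = 1 := by decide
    have ha1 : a = 1 := aux a ha
    rw [ha1, one_smul] at hy'
    obtain ⟨_, hbc, _, ⟨hd, w, hw, rfl⟩, hsum⟩ := Submodule.mem_sup.1 hy'
    obtain ⟨_, ⟨hb, u, hu, rfl⟩, _, ⟨hc, v, hv, rfl⟩, rfl⟩ := Submodule.mem_sup.1 hbc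
    -- From `z = D₁ u + D₂ v + D₁ w`, collecting the `D₁`- and `D₂`-terms gives `D₁ (x₁ + u + w) =
    -- D₂ (x₂ + v)`, while `D₁ u` and `D₁ w` lie in `[Fˣ]`.
    refine absurd ?_ (hnot (x₁ + u + w) (x₂ + v) ?_)
    · have hsum' : B.D₁ u + B.D₂ v + B.D₁ w = B.D₁ x₁ + B.D₂ x₂ := hsum
      have e : B.D₁ (x₁ + u + w) + B.D₂ (x₂ + v) =
          (B.D₁ u + B.D₂ v + B.D₁ w) + (B.D₁ x₁ + B.D₂ x₂) := by
        simp only [map_add]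
        abel
      rw [hsum', add_self, ← add_self (B.D₂ (x₂ + v)), add_left_inj] at e
      exact e
    · rw [map_add, map_add, add_assoc, add_sub_cancel_left]
      exact add_mem hb hd

end Presentation

end Biquadratic

/-! ### The theorem, by the dimension of the image of `T` -/

theorem theorem3 {F K : Type*} [Field F] [Field K] [Algebra F K] [IsGalois F K]
    (hchar : (2 : F) ≠ 0) (B : Biquadratic.Presentation F K) :
    -- the target of `T` consists of three copies of `ℤ/2`
    (Nat.card (Biquadratic.relSq B.K₁ K) = 2 ∧ Nat.card (Biquadratic.relSq B.K₂ K) = 2 ∧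
      Nat.card (Biquadratic.relSq B.K₃ K) = 2) ∧
    -- the kernel of `T` is `[Fˣ]`
    (LinearMap.ker B.T).map (Biquadratic.fixedJ F K).subtype = Biquadratic.baseClasses F K ∧
    ∃ X : Subrepresentation (Biquadratic.galJ F K),
      B.imT (Biquadratic.fixedPart X) = LinearMap.range B.T ∧
      (Module.finrank (ZMod 2) (LinearMap.range B.T) = 0 →
        X = ⊥) ∧
      (Module.finrank (ZMod 2) (LinearMap.range B.T) = 1 →
        Biquadratic.IsIso X (Biquadratic.triv F K)) ∧
      (Module.finrank (ZMod 2) (LinearMap.range B.T) = 2 →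
        B.IsCoordinatePlane (LinearMap.range B.T) →
        Biquadratic.IsIso X (B.omegaNeg 1)) ∧
      (Module.finrank (ZMod 2) (LinearMap.range B.T) = 2 →
        ¬ B.IsCoordinatePlane (LinearMap.range B.T) →
        Biquadratic.IsIso X ((Biquadratic.triv F K).prod (Biquadratic.triv F K))) ∧
      (Module.finrank (ZMod 2) (LinearMap.range B.T) = 3 →
        B.imT (Biquadratic.normClasses B.K₁ ⊓ Biquadratic.normClasses B.K₂) ≠ ⊥ →
        Biquadratic.IsIso X (B.omegaNeg 2)) ∧
      (Module.finrank (ZMod 2) (LinearMap.range B.T) = 3 →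
        B.imT (Biquadratic.normClasses B.K₁ ⊓ Biquadratic.normClasses B.K₂) = ⊥ →
        Biquadratic.IsIso X ((B.omegaNeg 1).prod (B.omegaNeg 1))) ∧
      -- all cases except the last
      (¬ (Module.finrank (ZMod 2) (LinearMap.range B.T) = 3 ∧
          B.imT (Biquadratic.normClasses B.K₁ ⊓ Biquadratic.normClasses B.K₂) = ⊥) →
        Biquadratic.baseClasses F K ⊓ Biquadratic.fixedPart X = ⊥) ∧
      -- the last case
      (Module.finrank (ZMod 2) (LinearMap.range B.T) = 3 →
        B.imT (Biquadratic.normClasses B.K₁ ⊓ Biquadratic.normClasses B.K₂) = ⊥ →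
        Module.finrank (ZMod 2)
            (Biquadratic.fixedPart X ⊓ Biquadratic.baseClasses F K :
              Submodule (ZMod 2) (Biquadratic.J K)) = 1 ∧
          Biquadratic.fixedPart X ⊓ (B.𝔅 ⊔ B.ℭ ⊔ B.𝔇) = ⊥) := by
  have hchar : (2 : K) ≠ 0 := by
    rw [← map_ofNat (algebraMap F K) 2]
    exact (map_ne_zero _).2 hchar
  refine ⟨⟨(B.isInvolutionOver_K₁ hchar).card_relSq hchar,
    (B.isInvolutionOver_K₂ hchar).card_relSq hchar,
    (B.isInvolutionOver_K₃ hchar).card_relSq hchar⟩, ?_, ?_⟩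
  · ext x
    constructor
    · rintro ⟨x, hx, rfl⟩
      refine (B.t_eq_zero_iff hchar x).1 ?_
      rwa [← map_zero (B.t hchar), B.t_eq_iff, map_zero]
    · intro hx
      have h := (B.t_eq_zero_iff hchar ⟨x, Biquadratic.Presentation.baseClasses_le_fixedJ hx⟩).2 hx
      rw [← map_zero (B.t hchar), B.t_eq_iff, map_zero] at h
      exact ⟨_, h, rfl⟩
  have hr := B.finrank_range_t hchar
  have hP : Module.finrank (ZMod 2) (ZMod 2 × ZMod 2 × ZMod 2) = 3 := by simp
  have hle : Module.finrank (ZMod 2) (LinearMap.range B.T) ≤ 3 := by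
    rw [← hr, ← hP]
    exact Submodule.finrank_le _
  generalize Module.finrank (ZMod 2) (LinearMap.range B.T) = n at *
  interval_cases n
  · refine ⟨⊥, B.imT_eq_range hchar fun p hp => ⟨0, zero_mem _, ?_⟩, ?_⟩
    · rw [Submodule.finrank_eq_zero.1 hr, Submodule.mem_bot] at hp
      rw [map_zero, hp]
    · simp only [forall_const, zero_ne_one, OfNat.zero_ne_ofNat, IsEmpty.forall_iff, false_and,
        not_false_eq_true, and_true, true_and]
      exact le_bot_iff.1 (inf_le_right.trans inf_le_left)
  · obtain ⟨X, h1, h2, h3⟩ := B.exists_isIso_of_trivial hchar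
      (ρ := Biquadratic.triv F K) (fun _ _ => rfl)
      (LinearEquiv.ofFinrankEq _ _ (by rw [hr, Module.finrank_self]))
    exact ⟨X, h2, by simp, fun _ => h1, by simp, by simp, by simp, by simp, fun _ => h3, by simp⟩
  · by_cases hc : B.IsCoordinatePlane (LinearMap.range B.T)
    · obtain ⟨X, h1, h2, h3⟩ := B.exists_isIso_of_isCoordinatePlane hchar hc
      exact ⟨X, h2, by simp, by simp, fun _ _ => h1, fun _ h => absurd hc h, by simp, by simp,
        fun _ => h3, by simp⟩
    · obtain ⟨X, h1, h2, h3⟩ := B.exists_isIso_of_trivial hchar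
        (ρ := (Biquadratic.triv F K).prod (Biquadratic.triv F K)) (fun _ _ => rfl)
        (LinearEquiv.ofFinrankEq _ _ (by rw [hr]; simp))
      exact ⟨X, h2, by simp, by simp, fun _ h => absurd h hc, fun _ _ => h1, by simp, by simp,
        fun _ => h3, by simp⟩
  · by_cases hS : B.imT (Biquadratic.normClasses B.K₁ ⊓ Biquadratic.normClasses B.K₂) = ⊥
    · obtain ⟨X, h1, h2, h3⟩ := B.exists_isIso_omegaNeg_one_prod hchar
        (Submodule.eq_top_of_finrank_eq (by rw [hr, hP])) hS
      exact ⟨X, h2, by simp, by simp, by simp, by simp, fun _ h => absurd hS h, fun _ _ => h1,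
        fun h => absurd ⟨rfl, hS⟩ h, fun _ _ => h3⟩
    · obtain ⟨X, h1, h2, h3⟩ := B.exists_isIso_omegaNeg_two hchar hS
      exact ⟨X, h2, by simp, by simp, by simp, by simp, fun _ _ => h1, fun _ h => absurd h hS,
        fun _ => h3, fun _ h => absurd h hS⟩
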